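/- Let $Y$ and $H$ be second countable locally compact Hausdorff spaces and let $\pi\colon H\to Y$ be a continuous open surjection. Let $\Theta=(\theta,H^{(1)},H^{(-1)})$ be a partial automorphism of $H$, i.e. $\theta\colon H^{(1)}\to H^{(-1)}$ is a homeomorphism between open subsets of $H$, and assume $\pi(\theta(x))=\pi(x)$ for all $x\in H^{(1)}$. For $k\in\mathbb{Z}$ let $H^{(k)}$ be the (open) domain of $\theta^k$, and identify $C_0(H^{(k)})$ with the functions in $C_0(H)$ vanishing outside $H^{(k)}$. The crossed product $C_0(H)\rtimes_\Theta\mathbb{Z}$ is the universal C$^*$-envelope (the separated completion for the largest C$^*$-seminorm) of the $^*$-algebra $\bigoplus_{k\in\mathbb{Z}}\{s^kf : f\in C_0(H^{(k)})\}$ with $$(s^kf)(s^lg)=s^{k+l}\,\theta^l(f\,\theta^{-l}(g)),\qquad (s^kf)^*=s^{-k}\,\theta^{-k}(f^*),\qquad \theta^l(h)=h\circ\theta^l \text{ on } H^{(l)},\ 0 \text{ elsewhere}.$$ For $y\in Y$ let $H_y=\pi^{-1}(y)$, let $\theta_y$ be the restriction of $\theta$ to $H^{(1)}\cap H_y\to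 H^{(-1)}\cap H_y$, and let $\Theta_y$ be the resulting partial automorphism of $H_y$. A $C_0(Y)$-algebra is a C$^*$-algebra $A$ with an injective nondegenerate $^*$-homomorphism $C_0(Y)\to M(A)$ with values in the centre of the multiplier algebra; $A_y=A/\overline{\mathrm{span}}\{ga : g\in C_0(Y),\ g(y)=0,\ a\in A\}$, the image of $a$ in $A_y$ is denoted $a_y$, and $A$ is a continuous field of C$^*$-algebras over $Y$ if $y\mapsto\|a_y\|$ is continuous on $Y$ for every $a\in A$. **Proposition.** The C$^*$-algebra $A=C_0(H)\rtimes_\Theta\mathbb{Z}$ is a $C_0(Y)$-algebra, with $g\cdot(s^kf)=s^k((g\circ\pi)f)$ for $g\in C_0(Y)$, $k\in\mathbb{Z}$ and $f\in C_0(H^{(k)})$. It is a continuous field of C$^*$-algebras over $Y$, and for every $y\in Y$ there is an isometric $^*$-isomorphism $$A_y\;\cong\;C_0(H_y)\rtimes_{\Theta_y}\mathbb{Z},\qquad (s^kf)_y\longmapsto s^k\,(f|_{H_y}).$$ -/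

import Mathlib

open scoped ZeroAtInfty MultiplierAlgebra DirectSum

set_option linter.unusedSectionVars false

/-! ### C⋆-seminorms and C⋆-completions of a ⋆-algebra -/

noncomputable section CStarSeminorm

/-- A C⋆-seminorm on a complex ⋆-algebra: a submultiplicative seminorm `p` with
`p (a⋆ a) = p a ^ 2`. -/
structure CStarSeminorm (A : Type*) [NonUnitalRing A] [StarRing A] [Module ℂ A] extends
    Seminorm ℂ A where
  mul_le' : ∀ a b : A, toFun (a * b) ≤ toFun a * toFun b
  star_mul_self' : ∀ a : A, toFun (star a * a) = toFun a ^ 2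

namespace CStarSeminorm

variable {A : Type*} [NonUnitalRing A] [StarRing A] [Module ℂ A]

instance : CoeFun (CStarSeminorm A) fun _ => A → ℝ := ⟨fun p => p.toFun⟩

theorem nonneg (p : CStarSeminorm A) (a : A) : 0 ≤ p a := apply_nonneg p.toSeminorm a

theorem star_eq (p : CStarSeminorm A) (a : A) : p (star a) = p a := by
  have key : ∀ b : A, p b ≤ p (star b) := by
    intro b
    rcases (p.nonneg b).eq_or_lt with h | h
    · rw [← h]; exact p.nonneg _
    · have h1 := p.mul_le' (star b) b
      rw [p.star_mul_self', sq] at h1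
      exact le_of_mul_le_mul_right h1 h
  exact le_antisymm (by simpa using key (star a)) (key a)

/-- The ⋆-algebra `A`, regarded as a seminormed space through the C⋆-seminorm `p`. -/
def Space (_p : CStarSeminorm A) : Type _ := A

variable (p : CStarSeminorm A)

instance : NonUnitalSeminormedRing p.Space where
  __ := p.toSeminorm.toAddGroupSeminorm.toSeminormedAddCommGroup
  __ := (inferInstance : NonUnitalRing A)
  norm_mul_le := p.mul_le'

instance : NormedSpace ℂ p.Space where
  __ := (inferInstance : Module ℂ A)
  norm_smul_le c (a : A) := (map_smul_eq_mul p.toSeminorm c a).le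

/-- The C⋆-algebra obtained from `A` by separation and completion with respect to `p`. -/
def Completion : Type _ := UniformSpace.Completion p.Space

namespace Completion

instance : NormedAddCommGroup p.Completion :=
  inferInstanceAs (NormedAddCommGroup (UniformSpace.Completion p.Space))

instance : NormedSpace ℂ p.Completion :=
  inferInstanceAs (NormedSpace ℂ (UniformSpace.Completion p.Space))

instance : CompleteSpace p.Completion :=
  inferInstanceAs (CompleteSpace (UniformSpace.Completion p.Space))

/-- The canonical map of `A` to its completion. -/
def of (a : A) : p.Completion := ((show p.Space from a : p.Space) : UniformSpace.Completion p.Space)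

variable {p}

theorem of_add (a b : A) : of p (a + b) = of p a + of p b :=
  UniformSpace.Completion.coe_add (α := p.Space) a b

theorem of_zero : of p (0 : A) = 0 := UniformSpace.Completion.coe_zero (α := p.Space)

theorem of_smul (c : ℂ) (a : A) : of p (c • a) = c • of p a :=
  UniformSpace.Completion.coe_smul (X := p.Space) (M := ℂ) c a

theorem norm_of (a : A) : ‖of p a‖ = p a := UniformSpace.Completion.norm_coe (E := p.Space) a

theorem of_sub (a b : A) : of p (a - b) = of p a - of p b :=
  UniformSpace.Completion.coe_sub (α := p.Space) a b

theorem denseRange_of : DenseRange (of p) :=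
  UniformSpace.Completion.denseRange_coe (α := p.Space)

theorem ind {P : p.Completion → Prop} (hP : IsClosed {x | P x}) (h : ∀ a, P (of p a))
    (x : p.Completion) : P x :=
  denseRange_of.induction_on x hP h

theorem continuous_of_space : Continuous (fun a : p.Space => (of p a : p.Completion)) :=
  UniformSpace.Completion.continuous_coe p.Space

instance : Mul p.Completion where
  mul := Function.curry <|
    ((UniformSpace.Completion.isDenseInducing_coe (α := p.Space)).prodMap
      (UniformSpace.Completion.isDenseInducing_coe (α := p.Space))).extend
        (fun ab : p.Space × p.Space => (of p (ab.1 * ab.2 : p.Space) : p.Completion))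

theorem of_mul (a b : A) : of p (a * b) = of p a * of p b :=
  (((UniformSpace.Completion.isDenseInducing_coe (α := p.Space)).prodMap
      (UniformSpace.Completion.isDenseInducing_coe (α := p.Space))).extend_eq
      (continuous_of_space.comp (continuous_mul (M := p.Space))) (a, b)).symm

instance : ContinuousMul p.Completion where
  continuous_mul := by
    let m : p.Space →+ p.Space →+ p.Completion :=
      (AddMonoidHom.mul : p.Space →+ p.Space →+ p.Space).compr₂ UniformSpace.Completion.toCompl
    have h : Continuous fun x : p.Space × p.Space => m x.1 x.2 :=
      continuous_of_space.comp (continuous_mul (M := p.Space))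
    have di : IsDenseInducing
        (UniformSpace.Completion.toCompl : p.Space → UniformSpace.Completion p.Space) :=
      UniformSpace.Completion.isDenseInducing_coe
    exact (di.extend_Z_bilin di h :)

theorem norm_mul_le_aux (x y : p.Completion) : ‖x * y‖ ≤ ‖x‖ * ‖y‖ := by
  refine ind (P := fun x => ‖x * y‖ ≤ ‖x‖ * ‖y‖) (isClosed_le (by fun_prop) (by fun_prop)) ?_ x
  intro a
  refine ind (P := fun y => ‖of p a * y‖ ≤ ‖of p a‖ * ‖y‖)
    (isClosed_le (by fun_prop) (by fun_prop)) ?_ y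
  intro b
  rw [← of_mul, norm_of, norm_of, norm_of]
  exact p.mul_le' a b

theorem ind₂ {P : p.Completion → p.Completion → Prop}
    (hP : IsClosed {x : p.Completion × p.Completion | P x.1 x.2})
    (h : ∀ a b, P (of p a) (of p b)) (x y : p.Completion) : P x y :=
  denseRange_of.induction_on₂ hP h x y

theorem ind₃ {P : p.Completion → p.Completion → p.Completion → Prop}
    (hP : IsClosed {x : p.Completion × p.Completion × p.Completion | P x.1 x.2.1 x.2.2})
    (h : ∀ a b c, P (of p a) (of p b) (of p c)) (x y z : p.Completion) : P x y z :=
  denseRange_of.induction_on₃ hP h x y z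

instance : NonUnitalNormedRing p.Completion where
  __ := (inferInstance : NormedAddCommGroup p.Completion)
  __ := (inferInstance : Mul p.Completion)
  norm_mul_le := norm_mul_le_aux
  zero_mul := ind (isClosed_eq (by fun_prop) (by fun_prop))
    fun a => by rw [← of_zero, ← of_mul, zero_mul]
  mul_zero := ind (isClosed_eq (by fun_prop) (by fun_prop))
    fun a => by rw [← of_zero, ← of_mul, mul_zero]
  mul_assoc := ind₃ (isClosed_eq (by fun_prop) (by fun_prop))
    fun a b c => by simp only [← of_mul, mul_assoc]
  left_distrib := ind₃ (isClosed_eq (by fun_prop) (by fun_prop))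
    fun a b c => by simp only [← of_mul, ← of_add, mul_add]
  right_distrib := ind₃ (isClosed_eq (by fun_prop) (by fun_prop))
    fun a b c => by simp only [← of_mul, ← of_add, add_mul]

/-- `a ↦ a⋆`, as an additive map of `A` to the completion. -/
def preStar (p : CStarSeminorm A) : p.Space →+ p.Completion where
  toFun a := of p (star (show A from a))
  map_zero' := (congrArg (of p) (star_zero A)).trans of_zero
  map_add' a b := (congrArg (of p) (star_add (R := A) a b)).trans (of_add _ _)

theorem continuous_preStar : Continuous (preStar p) :=
  AddMonoidHomClass.continuous_of_bound (preStar p) 1 fun a => by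
    rw [one_mul]
    exact ((norm_of _).trans (p.star_eq a)).le

/-- The extension of `a ↦ a⋆` to the completion. -/
def starHom (p : CStarSeminorm A) : p.Completion →+ p.Completion :=
  (preStar p).extension continuous_preStar

theorem continuous_starHom : Continuous (starHom p) :=
  AddMonoidHom.continuous_extension _ continuous_preStar

theorem starHom_of (a : A) : starHom p (of p a) = of p (star a) :=
  AddMonoidHom.extension_coe (preStar p) continuous_preStar a

instance : StarRing p.Completion where
  star := starHom p
  star_involutive := ind (isClosed_eq (continuous_starHom.comp continuous_starHom) continuous_id)
    fun a => by rw [starHom_of, starHom_of, star_star]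
  star_mul := ind₂ (isClosed_eq (continuous_starHom.comp (by fun_prop))
      ((continuous_starHom.comp (by fun_prop)).mul (continuous_starHom.comp (by fun_prop))))
    fun a b => by
      change starHom p (of p a * of p b) = starHom p (of p b) * starHom p (of p a)
      simp only [starHom_of, ← of_mul, star_mul]
  star_add := map_add (starHom p)

theorem of_star (a : A) : of p (star a) = star (of p a) := (starHom_of a).symm

theorem continuous_star : Continuous (star : p.Completion → p.Completion) := continuous_starHom

instance : CStarRing p.Completion where
  norm_mul_self_le := by
    refine ind (isClosed_le (by fun_prop) ((continuous_star.mul continuous_id).norm)) fun a => ?_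
    rw [← of_star, ← of_mul, norm_of, norm_of, p.star_mul_self', sq]

theorem continuous_smul_const (c : ℂ) : Continuous fun x : p.Completion => c • x :=
  continuous_const_smul c

/-- The completion of a ⋆-algebra with respect to a C⋆-seminorm is a C⋆-algebra. -/
instance [IsScalarTower ℂ A A] [SMulCommClass ℂ A A] [StarModule ℂ A] :
    NonUnitalCStarAlgebra p.Completion where
  __ := (inferInstance : NonUnitalNormedRing p.Completion)
  __ := (inferInstance : StarRing p.Completion)
  __ := (inferInstance : CStarRing p.Completion)
  __ := (inferInstance : CompleteSpace p.Completion)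
  __ := (inferInstance : NormedSpace ℂ p.Completion)
  smul_assoc c x y := by
    refine ind₂ (P := fun x y => (c • x) * y = c • (x * y))
      (isClosed_eq (((continuous_smul_const c).comp continuous_fst).mul continuous_snd)
        ((continuous_smul_const c).comp continuous_mul)) (fun a b => ?_) x y
    simp only [← of_smul, ← of_mul, smul_mul_assoc]
  smul_comm c x y := by
    refine ind₂ (P := fun x y => c • (x * y) = x * (c • y))
      (isClosed_eq ((continuous_smul_const c).comp continuous_mul)
        (continuous_fst.mul ((continuous_smul_const c).comp continuous_snd))) (fun a b => ?_) x y
    simp only [← of_smul, ← of_mul, mul_smul_comm]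
  star_smul c := by
    refine ind (isClosed_eq (continuous_star.comp (continuous_smul_const c))
      ((continuous_smul_const _).comp continuous_star)) fun a => ?_
    simp only [← of_smul, ← of_star, star_smul]

/-- The canonical ⋆-homomorphism of `A` to its completion. -/
def ofHom (p : CStarSeminorm A) : A →⋆ₙₐ[ℂ] p.Completion where
  toFun := of p
  map_smul' := of_smul
  map_zero' := of_zero
  map_add' := of_add
  map_mul' := of_mul
  map_star' := of_star

end Completion

/-! ### The largest C⋆-seminorm -/

instance : Zero (CStarSeminorm A) where
  zero :=
    { (0 : Seminorm ℂ A) with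
      mul_le' := fun _ _ => (mul_zero (0 : ℝ)).ge
      star_mul_self' := fun _ => (zero_pow (M₀ := ℝ) two_ne_zero).symm }

/-- The largest C⋆-seminorm, `a ↦ sup_p p a`, on a ⋆-algebra on which the C⋆-seminorms are
pointwise bounded. -/
def universal (h : ∀ a : A, BddAbove (Set.range fun p : CStarSeminorm A => p a)) :
    CStarSeminorm A where
  toFun a := ⨆ p : CStarSeminorm A, p a
  map_zero' := by
    have : ∀ p : CStarSeminorm A, p 0 = 0 := fun p => map_zero p.toSeminorm
    simp [this]
  add_le' a b := ciSup_le fun p => (map_add_le_add p.toSeminorm a b).trans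
    (add_le_add (le_ciSup (h a) p) (le_ciSup (h b) p))
  neg' a := by
    have : ∀ p : CStarSeminorm A, p (-a) = p a := fun p => map_neg_eq_map p.toSeminorm a
    simp [this]
  smul' c a := by
    have : ∀ p : CStarSeminorm A, p (c • a) = ‖c‖ * p a :=
      fun p => map_smul_eq_mul p.toSeminorm c a
    simp only [this]
    exact (Real.mul_iSup_of_nonneg (norm_nonneg c) _).symm
  mul_le' a b := ciSup_le fun p => (p.mul_le' a b).trans
    (mul_le_mul (le_ciSup (h a) p) (le_ciSup (h b) p) (p.nonneg b)
      ((p.nonneg a).trans (le_ciSup (h a) p)))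
  star_mul_self' a := by
    have h0 : (0 : ℝ) ≤ ⨆ p : CStarSeminorm A, p a :=
      Real.iSup_nonneg fun p => p.nonneg a
    apply le_antisymm
    · refine ciSup_le fun p => ?_
      change p (star a * a) ≤ _
      rw [p.star_mul_self']
      exact pow_le_pow_left₀ (p.nonneg a) (le_ciSup (h a) p) 2
    · have hs : (0 : ℝ) ≤ ⨆ p : CStarSeminorm A, p (star a * a) :=
        Real.iSup_nonneg fun p => p.nonneg _
      rw [← Real.le_sqrt h0 hs]
      refine ciSup_le fun p => Real.le_sqrt_of_sq_le ?_
      rw [← p.star_mul_self']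
      exact le_ciSup (h (star a * a)) p

theorem le_universal (h : ∀ a : A, BddAbove (Set.range fun p : CStarSeminorm A => p a))
    (p : CStarSeminorm A) (a : A) : p a ≤ universal h a := le_ciSup (h a) p

/-- A C⋆-seminorm is dominated by the norm along every ⋆-homomorphism from a C⋆-algebra. -/
theorem apply_le_norm [IsScalarTower ℂ A A] [SMulCommClass ℂ A A] [StarModule ℂ A]
    (p : CStarSeminorm A) {B : Type*} [NonUnitalCStarAlgebra B] (φ : B →⋆ₙₐ[ℂ] A) (b : B) :
    p (φ b) ≤ ‖b‖ := by
  rw [← Completion.norm_of]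
  exact NonUnitalStarAlgHom.norm_apply_le ((Completion.ofHom p).comp φ) b

end CStarSeminorm
end CStarSeminorm

/-! ### Powers of a partial automorphism

A partial automorphism of a space `X` (a homeomorphism between two open subsets of `X`) is an
`OpenPartialHomeomorph X X`. -/

namespace PartialAut

noncomputable section

variable {X : Type*} [TopologicalSpace X]

/-- The `n`-fold composition of a partial automorphism, on its natural domain. -/
def npow (θ : OpenPartialHomeomorph X X) : ℕ → OpenPartialHomeomorph X X
  | 0 => OpenPartialHomeomorph.refl X
  | n + 1 => (npow θ n).trans θ

/-- The integral powers of a partial automorphism, on their natural domains. -/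
def zpow (θ : OpenPartialHomeomorph X X) : ℤ → OpenPartialHomeomorph X X
  | Int.ofNat n => npow θ n
  | Int.negSucc n => (npow θ (n + 1)).symm

/-- `θ ^ k` is defined at `x` and takes the value `y` there. -/
def Rel (θ : OpenPartialHomeomorph X X) (k : ℤ) (x y : X) : Prop :=
  x ∈ (zpow θ k).source ∧ zpow θ k x = y

variable {θ : OpenPartialHomeomorph X X}

theorem zpow_neg (k : ℤ) : zpow θ (-k) = (zpow θ k).symm := by
  rcases k with (_ | n) | n
  · rfl
  · rfl
  · exact (OpenPartialHomeomorph.symm_symm (npow θ (n + 1))).symm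

theorem rel_symm_iff (e : OpenPartialHomeomorph X X) (x y : X) :
    (x ∈ e.source ∧ e x = y) ↔ (y ∈ e.symm.source ∧ e.symm y = x) := by
  constructor
  · rintro ⟨hx, rfl⟩; exact ⟨e.map_source hx, e.left_inv hx⟩
  · rintro ⟨hy, rfl⟩; exact ⟨e.map_target hy, e.right_inv hy⟩

theorem rel_neg {k : ℤ} {x y : X} : Rel θ (-k) x y ↔ Rel θ k y x := by
  unfold Rel
  rw [zpow_neg, ← rel_symm_iff]

theorem rel_zero {x y : X} : Rel θ 0 x y ↔ x = y := by
  change (x ∈ Set.univ ∧ x = y) ↔ _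
  simp

theorem rel_natSucc {n : ℕ} {x z : X} :
    Rel θ (n + 1 : ℕ) x z ↔ ∃ y, Rel θ n x y ∧ (y ∈ θ.source ∧ θ y = z) := by
  constructor
  · rintro ⟨h, rfl⟩
    change x ∈ ((npow θ n).trans θ).source at h
    rw [OpenPartialHomeomorph.trans_source] at h
    exact ⟨_, ⟨h.1, rfl⟩, h.2, rfl⟩
  · rintro ⟨_, ⟨h, rfl⟩, h', rfl⟩
    refine ⟨?_, rfl⟩
    change x ∈ ((npow θ n).trans θ).source
    rw [OpenPartialHomeomorph.trans_source]
    exact ⟨h, h'⟩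

theorem rel_natSucc' {n : ℕ} {x z : X} :
    Rel θ (n + 1 : ℕ) x z ↔ ∃ y, (x ∈ θ.source ∧ θ x = y) ∧ Rel θ n y z := by
  induction n generalizing z with
  | zero =>
    rw [rel_natSucc]
    simp only [Nat.cast_zero, rel_zero]
    simp
  | succ n ih =>
    rw [rel_natSucc]
    constructor
    · rintro ⟨y, h, h'⟩
      obtain ⟨w, hw, hw'⟩ := ih.1 h
      exact ⟨w, hw, rel_natSucc.2 ⟨y, hw', h'⟩⟩
    · rintro ⟨w, hw, hw'⟩
      obtain ⟨y, h, h'⟩ := rel_natSucc.1 hw'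
      exact ⟨y, ih.2 ⟨w, hw, h⟩, h'⟩

theorem Rel.step {k : ℤ} {x y z : X} (h : Rel θ k x y) (h' : y ∈ θ.source ∧ θ y = z) :
    Rel θ (k + 1) x z := by
  rcases k with n | n
  · exact rel_natSucc.2 ⟨y, h, h'⟩
  · have h2 : Rel θ (n + 1 : ℕ) y x := rel_neg.1 h
    obtain ⟨w, hw, hw'⟩ := rel_natSucc'.1 h2
    obtain rfl : z = w := h'.2.symm.trans hw.2
    have : (Int.negSucc n : ℤ) + 1 = -(n : ℤ) := by omega
    rw [this, rel_neg]
    exact hw'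

theorem Rel.back {k : ℤ} {x y z : X} (h : Rel θ k x y) (h' : z ∈ θ.source ∧ θ z = y) :
    Rel θ (k - 1) x z := by
  rcases k with (_ | n) | n
  · have h2 : Rel θ (0 + 1 : ℕ) z x := rel_natSucc'.2 ⟨y, h', rel_zero.2 (rel_zero.1 h).symm⟩
    exact rel_neg.1 (by simpa using h2)
  · obtain ⟨w, hw, hw'⟩ := rel_natSucc.1 (show Rel θ (n + 1 : ℕ) x y from h)
    obtain rfl : w = z := θ.injOn hw'.1 h'.1 (hw'.2.trans h'.2.symm)
    have : (Int.ofNat (n + 1) : ℤ) - 1 = n := by simp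
    rw [this]
    exact hw
  · have h2 : Rel θ (n + 1 : ℕ) y x := rel_neg.1 h
    have h3 : Rel θ (n + 1 + 1 : ℕ) z x := rel_natSucc'.2 ⟨y, h', h2⟩
    have : (Int.negSucc n : ℤ) - 1 = -((n + 1 + 1 : ℕ) : ℤ) := by omega
    rw [this, rel_neg]
    exact h3

theorem Rel.add {k l : ℤ} {x y z : X} (h : Rel θ l x y) (h' : Rel θ k y z) :
    Rel θ (k + l) x z := by
  rcases k with n | n
  · change Rel θ (n : ℤ) y z at h'
    change Rel θ ((n : ℤ) + l) x z
    induction n generalizing z with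
    | zero =>
      obtain rfl := rel_zero.1 h'
      simpa using h
    | succ n ih =>
      obtain ⟨w, hw, hw'⟩ := rel_natSucc.1 h'
      have := (ih hw).step hw'
      rwa [show ((n + 1 : ℕ) : ℤ) + l = n + l + 1 by push_cast; ring]
  · have h2 : Rel θ (n + 1 : ℕ) z y := rel_neg.1 h'
    have key : ∀ m : ℕ, ∀ w, Rel θ m w y → Rel θ (-(m : ℤ) + l) x w := by
      intro m
      induction m with
      | zero =>
        intro w hw
        obtain rfl := rel_zero.1 hw
        simpa using h
      | succ m ih =>
        intro w hw
        obtain ⟨v, hv, hv'⟩ := rel_natSucc'.1 hw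
        have := (ih v hv').back hv
        rwa [show -((m + 1 : ℕ) : ℤ) + l = -(m : ℤ) + l - 1 by push_cast; ring]
    exact key (n + 1) z h2

theorem Rel.mk {k : ℤ} {x : X} (h : x ∈ (zpow θ k).source) : Rel θ k x (zpow θ k x) := ⟨h, rfl⟩

/-! ### The ⋆-algebra of a partial automorphism -/

variable [T2Space X]

/-- The function `f ∘ e` on the domain of `e`, extended by `0`, for `f ∈ C₀(X)` vanishing outside
the range of `e`. -/
def pull (e : OpenPartialHomeomorph X X) (f : C₀(X, ℂ)) (hf : ∀ x ∉ e.target, f x = 0) :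
    C₀(X, ℂ) :=
  haveI key : ∀ ε > 0, ∃ K : Set X, IsCompact K ∧ K ⊆ e.source ∧
      ∀ x ∉ K, ‖e.source.indicator (f ∘ e) x‖ < ε := by
    intro ε hε
    have h1 : ∀ᶠ x in Filter.cocompact X, ‖f x‖ < ε := by
      have := (zero_at_infty f).norm
      rw [norm_zero] at this
      exact this.eventually_lt_const hε
    obtain ⟨K, hK, hK'⟩ := Filter.mem_cocompact.1 h1
    have hK2 : IsCompact (K ∩ {x | ε ≤ ‖f x‖}) :=
      hK.inter_right (isClosed_le continuous_const (map_continuous f).norm)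
    have hsub : K ∩ {x | ε ≤ ‖f x‖} ⊆ e.target := by
      rintro x ⟨-, hx⟩
      by_contra hxt
      rw [Set.mem_ofPred_eq, hf x hxt, norm_zero] at hx
      exact absurd hx (not_le.2 hε)
    refine ⟨e.symm '' (K ∩ {x | ε ≤ ‖f x‖}),
      hK2.image_of_continuousOn (e.continuousOn_symm.mono hsub), ?_, ?_⟩
    · rintro _ ⟨x, hx, rfl⟩
      exact e.map_target (hsub hx)
    · intro x hx
      by_cases hxs : x ∈ e.source
      · rw [Set.indicator_of_mem hxs]
        by_contra hlt
        refine hx ⟨e x, ⟨?_, not_lt.1 hlt⟩, e.left_inv hxs⟩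
        by_contra hxK
        exact hlt (hK' hxK)
      · rw [Set.indicator_of_notMem hxs, norm_zero]
        exact hε
  { toFun := e.source.indicator (f ∘ e)
    continuous_toFun := by
      rw [continuous_iff_continuousAt]
      intro x
      by_cases hxs : x ∈ e.source
      · have h1 : ContinuousAt (f ∘ e) x :=
          (map_continuous f).continuousAt.comp (e.continuousAt hxs)
        refine h1.congr ?_
        filter_upwards [e.open_source.mem_nhds hxs] with y hy
        rw [Set.indicator_of_mem hy]
      · rw [ContinuousAt, Set.indicator_of_notMem hxs, tendsto_zero_iff_norm_tendsto_zero,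
          Metric.tendsto_nhds]
        intro ε hε
        obtain ⟨K, hK, hKs, hK'⟩ := key ε hε
        filter_upwards [hK.isClosed.isOpen_compl.mem_nhds fun h => hxs (hKs h)] with y hy
        simpa using hK' y hy
    zero_at_infty' := by
      rw [tendsto_zero_iff_norm_tendsto_zero, Metric.tendsto_nhds]
      intro ε hε
      obtain ⟨K, hK, -, hK'⟩ := key ε hε
      filter_upwards [hK.compl_mem_cocompact] with y hy
      simpa using hK' y hy }

theorem pull_apply_of_mem {e : OpenPartialHomeomorph X X} {f : C₀(X, ℂ)} {hf} {x : X}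
    (hx : x ∈ e.source) : pull e f hf x = f (e x) :=
  Set.indicator_of_mem hx _

theorem pull_apply_of_notMem {e : OpenPartialHomeomorph X X} {f : C₀(X, ℂ)} {hf} {x : X}
    (hx : x ∉ e.source) : pull e f hf x = 0 :=
  Set.indicator_of_notMem hx _

/-- `C₀(U)` for the domain `U` of `θ ^ k`, as the ideal of the functions in `C₀(X)` that vanish
outside `U`. Its element `f` stands for the symbol `s ^ k f`. -/
def N (θ : OpenPartialHomeomorph X X) (k : ℤ) : Submodule ℂ C₀(X, ℂ) where
  carrier := {f | ∀ x ∉ (zpow θ k).source, f x = 0}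
  add_mem' hf hg x hx := by simp [hf x hx, hg x hx]
  zero_mem' _ _ := rfl
  smul_mem' c f hf x hx := by simp [hf x hx]

theorem N.vanish {k : ℤ} (f : N θ k) : ∀ x ∉ (zpow θ k).symm.target, f.1 x = 0 := f.2

theorem mulN_aux {k l : ℤ} (f : N θ k) (g : N θ l) : ∀ x ∉ (zpow θ l).target,
    (f.1 * pull (zpow θ l).symm g.1 (N.vanish g)) x = 0 := fun x hx => by
  rw [ZeroAtInftyContinuousMap.mul_apply, pull_apply_of_notMem hx, mul_zero]

theorem starN_aux {k : ℤ} (f : N θ k) : ∀ x ∉ (zpow θ (-k)).target, star f.1 x = 0 := by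
  intro x hx
  rw [zpow_neg] at hx
  rw [ZeroAtInftyContinuousMap.star_apply, f.2 x hx, star_zero]

/-- The product `(s ^ k f) (s ^ l g) = s ^ (k + l) θ ^ l (f θ ^ (-l) (g))`. -/
def mulN {k l : ℤ} (f : N θ k) (g : N θ l) : N θ (k + l) :=
  ⟨pull (zpow θ l) (f.1 * pull (zpow θ l).symm g.1 (N.vanish g)) (mulN_aux f g), by
    intro x hx
    by_cases hl : x ∈ (zpow θ l).source
    · rw [pull_apply_of_mem hl, ZeroAtInftyContinuousMap.mul_apply]
      by_cases hk : zpow θ l x ∈ (zpow θ k).source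
      · exact absurd ((Rel.mk hl).add (Rel.mk hk)).1 hx
      · rw [f.2 _ hk, zero_mul]
    · exact pull_apply_of_notMem hl⟩

theorem mulN_apply {k l : ℤ} (f : N θ k) (g : N θ l) (x : X) :
    (mulN f g).1 x = f.1 (zpow θ l x) * g.1 x := by
  by_cases hl : x ∈ (zpow θ l).source
  · refine (pull_apply_of_mem (hf := mulN_aux f g) hl).trans ?_
    rw [ZeroAtInftyContinuousMap.mul_apply, pull_apply_of_mem ((zpow θ l).map_source hl),
      (zpow θ l).left_inv hl]
  · refine (pull_apply_of_notMem (hf := mulN_aux f g) hl).trans ?_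
    rw [g.2 x hl, mul_zero]

/-- The involution `(s ^ k f)⋆ = s ^ (-k) θ ^ (-k) (f⋆)`. -/
def starN {k : ℤ} (f : N θ k) : N θ (-k) :=
  ⟨pull (zpow θ (-k)) (star f.1) (starN_aux f), fun _ hx => pull_apply_of_notMem hx⟩

theorem starN_apply_of_rel {k : ℤ} (f : N θ k) {x y : X} (h : Rel θ k y x) :
    (starN f).1 x = star (f.1 y) := by
  obtain ⟨h1, h2⟩ := rel_neg.2 h
  refine (pull_apply_of_mem (hf := starN_aux f) h1).trans ?_
  rw [h2]
  rfl

theorem starN_apply_of_not {k : ℤ} (f : N θ k) {x : X} (h : ∀ y, ¬ Rel θ k y x) :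
    (starN f).1 x = 0 :=
  pull_apply_of_notMem (hf := starN_aux f) fun hx => h _ (rel_neg.1 (Rel.mk hx))

/-- The direct sum of the spaces of symbols `s ^ k f`, over `k : ℤ`. -/
def Alg (θ : OpenPartialHomeomorph X X) : Type _ := ⨁ k : ℤ, N θ k

namespace Alg

instance : AddCommMonoid (Alg θ) := inferInstanceAs (AddCommMonoid (⨁ k : ℤ, N θ k))

instance : Module ℂ (Alg θ) := inferInstanceAs (Module ℂ (⨁ k : ℤ, N θ k))

instance : AddCommGroup (Alg θ) := Module.addCommMonoidToAddCommGroup ℂ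

/-- The symbol `s ^ k f`. -/
def sym (θ : OpenPartialHomeomorph X X) (k : ℤ) : N θ k →ₗ[ℂ] Alg θ :=
  DirectSum.lof ℂ ℤ (fun k => N θ k) k

theorem sym_congr {k l : ℤ} (h : k = l) (f : N θ k) (g : N θ l) (hfg : ∀ x, f.1 x = g.1 x) :
    sym θ k f = sym θ l g := by
  subst h
  congr 1
  exact Subtype.ext (ZeroAtInftyContinuousMap.ext hfg)

instance : DirectSum.GNonUnitalNonAssocSemiring (fun k : ℤ => N θ k) where
  mul := mulN
  mul_zero a := by
    refine Subtype.ext (ZeroAtInftyContinuousMap.ext fun x => (mulN_apply _ _ x).trans ?_); simp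
  zero_mul a := by
    refine Subtype.ext (ZeroAtInftyContinuousMap.ext fun x => (mulN_apply _ _ x).trans ?_); simp
  mul_add a b c := by
    refine Subtype.ext (ZeroAtInftyContinuousMap.ext fun x => ?_)
    change (mulN _ _).1 x = (mulN _ _).1 x + (mulN _ _).1 x
    simp only [mulN_apply]
    exact mul_add _ _ _
  add_mul a b c := by
    refine Subtype.ext (ZeroAtInftyContinuousMap.ext fun x => ?_)
    change (mulN _ _).1 x = (mulN _ _).1 x + (mulN _ _).1 x
    simp only [mulN_apply]
    exact add_mul _ _ _

instance : NonUnitalNonAssocSemiring (Alg θ) :=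
  inferInstanceAs (NonUnitalNonAssocSemiring (⨁ k : ℤ, N θ k))

instance : NonUnitalNonAssocRing (Alg θ) where
  __ := (inferInstance : AddCommGroup (Alg θ))
  __ := (inferInstance : NonUnitalNonAssocSemiring (Alg θ))

theorem sym_mul_sym {k l : ℤ} (f : N θ k) (g : N θ l) :
    sym θ k f * sym θ l g = sym θ (k + l) (mulN f g) :=
  DirectSum.of_mul_of (A := fun k : ℤ => N θ k) f g

theorem ind {P : Alg θ → Prop} (h0 : P 0) (hs : ∀ k f, P (sym θ k f))
    (ha : ∀ a b, P a → P b → P (a + b)) (a : Alg θ) : P a :=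
  DirectSum.induction_on a h0 hs ha

theorem sym_assoc {k l m : ℤ} (f : N θ k) (g : N θ l) (h : N θ m) :
    sym θ k f * sym θ l g * sym θ m h = sym θ k f * (sym θ l g * sym θ m h) := by
  simp only [sym_mul_sym]
  refine sym_congr (add_assoc k l m) _ _ fun x => ?_
  simp only [mulN_apply]
  by_cases hm : x ∈ (zpow θ m).source
  · by_cases hl : zpow θ m x ∈ (zpow θ l).source
    · rw [((Rel.mk hm).add (Rel.mk hl)).2, mul_assoc]
    · simp [g.2 _ hl]
  · simp [h.2 _ hm]

instance : NonUnitalRing (Alg θ) where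
  __ := (inferInstance : NonUnitalNonAssocRing (Alg θ))
  mul_assoc a b c := by
    refine ind (P := fun a => a * b * c = a * (b * c)) (by simp) (fun k f => ?_)
      (fun a a' h h' => by rw [add_mul, add_mul, add_mul, h, h']) a
    refine ind (P := fun b => sym θ k f * b * c = sym θ k f * (b * c)) (by simp) (fun l g => ?_)
      (fun a a' h h' => by rw [mul_add, add_mul, add_mul, mul_add, h, h']) b
    exact ind (P := fun c => sym θ k f * sym θ l g * c = sym θ k f * (sym θ l g * c)) (by simp)
      (fun m h => sym_assoc f g h)
      (fun a a' h h' => by rw [mul_add, mul_add, mul_add, h, h']) c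

instance : IsScalarTower ℂ (Alg θ) (Alg θ) where
  smul_assoc c a b := by
    simp only [smul_eq_mul]
    refine ind (P := fun a => c • a * b = c • (a * b)) (by simp) (fun k f => ?_)
      (fun a a' h h' => by rw [smul_add, add_mul, add_mul, smul_add, h, h']) a
    refine ind (P := fun b => c • sym θ k f * b = c • (sym θ k f * b)) (by simp) (fun l g => ?_)
      (fun a a' h h' => by rw [mul_add, mul_add, smul_add, h, h']) b
    rw [← map_smul, sym_mul_sym, sym_mul_sym, ← map_smul]
    refine sym_congr rfl _ _ fun x => ?_
    change _ = c * (mulN f g).1 x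
    rw [mulN_apply, mulN_apply, ← mul_assoc]
    rfl

instance : SMulCommClass ℂ (Alg θ) (Alg θ) where
  smul_comm c a b := by
    simp only [smul_eq_mul]
    refine ind (P := fun a => c • (a * b) = a * c • b) (by simp) (fun k f => ?_)
      (fun a a' h h' => by rw [add_mul, add_mul, smul_add, h, h']) a
    refine ind (P := fun b => c • (sym θ k f * b) = sym θ k f * c • b) (by simp) (fun l g => ?_)
      (fun a a' h h' => by rw [smul_add, mul_add, mul_add, smul_add, h, h']) b
    rw [← map_smul, sym_mul_sym, sym_mul_sym, ← map_smul]
    refine sym_congr rfl _ _ fun x => ?_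
    change c * (mulN f g).1 x = _
    rw [mulN_apply, mulN_apply]
    exact mul_left_comm _ _ _

theorem starN_add {k : ℤ} (f g : N θ k) : starN (f + g) = starN f + starN g := by
  refine Subtype.ext (ZeroAtInftyContinuousMap.ext fun x => ?_)
  change (starN (f + g)).1 x = (starN f).1 x + (starN g).1 x
  by_cases h : ∃ y, Rel θ k y x
  · obtain ⟨y, hy⟩ := h
    simp only [starN_apply_of_rel _ hy]
    exact star_add _ _
  · simp only [starN_apply_of_not _ (not_exists.1 h), add_zero]

/-- The involution, as an additive map. -/
def starHom : Alg θ →+ Alg θ :=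
  DirectSum.toAddMonoid (β := fun k : ℤ => N θ k) fun k =>
    AddMonoidHom.mk' (fun f => sym θ (-k) (starN f)) fun f g => by rw [starN_add, map_add]

theorem starHom_sym {k : ℤ} (f : N θ k) : starHom (sym θ k f) = sym θ (-k) (starN f) :=
  DirectSum.toAddMonoid_of (β := fun k : ℤ => N θ k) _ k f

instance : StarRing (Alg θ) where
  star := starHom
  star_involutive := by
    refine ind (by simp) (fun k f => ?_) fun a b ha hb => by simp [ha, hb]
    rw [starHom_sym, starHom_sym]
    refine sym_congr (neg_neg k) _ _ fun x => ?_
    by_cases h : ∃ y, Rel θ (-k) y x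
    · obtain ⟨y, hy⟩ := h
      rw [starN_apply_of_rel _ hy, starN_apply_of_rel _ (rel_neg.1 hy), star_star]
    · rw [starN_apply_of_not _ (not_exists.1 h)]
      refine (f.2 x fun hx => h ⟨_, rel_neg.2 (Rel.mk hx)⟩).symm
  star_mul a b := by
    refine ind (P := fun a => starHom (a * b) = starHom b * starHom a) (by simp) (fun k f => ?_)
      (fun a a' h h' => by rw [add_mul, map_add, map_add, mul_add, h, h']) a
    refine ind (P := fun b => starHom (sym θ k f * b) = starHom b * starHom (sym θ k f)) (by simp)
      (fun l g => ?_)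
      (fun a a' h h' => by rw [mul_add, map_add, map_add, add_mul, h, h']) b
    simp only [sym_mul_sym, starHom_sym]
    refine sym_congr (by ring) _ _ fun x => ?_
    rw [mulN_apply]
    by_cases hk : ∃ y, Rel θ k y x
    · obtain ⟨y, hy⟩ := hk
      rw [starN_apply_of_rel f hy, (rel_neg.2 hy).2]
      by_cases hl : ∃ z, Rel θ l z y
      · obtain ⟨z, hz⟩ := hl
        rw [starN_apply_of_rel _ hz, starN_apply_of_rel _ (hz.add hy), mulN_apply, hz.2, star_mul]
      · rw [starN_apply_of_not _ (not_exists.1 hl), zero_mul]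
        by_cases hw : ∃ w, Rel θ (k + l) w x
        · obtain ⟨w, hw⟩ := hw
          rw [starN_apply_of_rel _ hw, mulN_apply]
          have : w ∉ (zpow θ l).source := fun hs => by
            have h1 := ((Rel.mk hs).add (rel_neg.2 (Rel.mk hs)))
            have h2 := (rel_neg.2 (Rel.mk hs)).add hw
            have h3 : Rel θ k (zpow θ l w) x := by
              simpa using h2
            have h4 := (rel_neg.2 h3).2.symm.trans (rel_neg.2 hy).2
            exact hl ⟨w, hs, h4⟩
          rw [g.2 w this, mul_zero, star_zero]
        · rw [starN_apply_of_not _ (not_exists.1 hw)]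
    · rw [starN_apply_of_not f (not_exists.1 hk), mul_zero]
      by_cases hw : ∃ w, Rel θ (k + l) w x
      · obtain ⟨w, hw⟩ := hw
        rw [starN_apply_of_rel _ hw, mulN_apply]
        by_cases hs : w ∈ (zpow θ l).source
        · have h2 := (rel_neg.2 (Rel.mk hs)).add hw
          exact absurd ⟨_, by simpa using h2⟩ hk
        · rw [g.2 w hs, mul_zero, star_zero]
      · rw [starN_apply_of_not _ (not_exists.1 hw)]
  star_add := map_add starHom

theorem star_sym {k : ℤ} (f : N θ k) : star (sym θ k f) = sym θ (-k) (starN f) := starHom_sym f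

instance : StarModule ℂ (Alg θ) where
  star_smul c := by
    refine ind (by simp) (fun k f => ?_) fun a b ha hb => by
      rw [smul_add, star_add, star_add, smul_add, ha, hb]
    rw [← map_smul, star_sym, star_sym, ← map_smul]
    refine sym_congr rfl _ _ fun x => ?_
    change _ = star c * (starN f).1 x
    by_cases h : ∃ y, Rel θ k y x
    · obtain ⟨y, hy⟩ := h
      rw [starN_apply_of_rel _ hy, starN_apply_of_rel _ hy]
      exact star_mul' _ _
    · simp only [starN_apply_of_not _ (not_exists.1 h), mul_zero]

end Alg

/-- The inclusion of `C₀(X)`, `f ↦ s ^ 0 f`. -/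
def incl (θ : OpenPartialHomeomorph X X) : C₀(X, ℂ) →⋆ₙₐ[ℂ] Alg θ where
  toFun f := Alg.sym θ 0 ⟨f, fun x hx => absurd (Rel.add (rel_zero.2 rfl) (rel_zero.2 rfl)).1 hx⟩
  map_smul' c f := map_smul (Alg.sym θ 0) c (⟨f, _⟩ : N θ 0)
  map_zero' := map_zero (Alg.sym θ 0)
  map_add' f g := map_add (Alg.sym θ 0) (⟨f, _⟩ : N θ 0) ⟨g, _⟩
  map_mul' f g := by
    rw [Alg.sym_mul_sym]
    refine Alg.sym_congr (zero_add 0).symm _ _ fun x => ?_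
    rw [mulN_apply]
    rfl
  map_star' f := by
    rw [Alg.star_sym]
    refine Alg.sym_congr neg_zero.symm _ _ fun x => ?_
    rw [starN_apply_of_rel _ (rel_zero.2 rfl : Rel θ 0 x x)]
    rfl

theorem bddAbove_sym {k : ℤ} (f : N θ k) :
    BddAbove (Set.range fun p : CStarSeminorm (Alg θ) => p (Alg.sym θ k f)) := by
  have h : star (Alg.sym θ k f) * Alg.sym θ k f = incl θ (star f.1 * f.1) := by
    rw [Alg.star_sym, Alg.sym_mul_sym]
    refine Alg.sym_congr (neg_add_cancel k) _ _ fun x => ?_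
    rw [mulN_apply]
    by_cases hx : x ∈ (zpow θ k).source
    · rw [starN_apply_of_rel f (Rel.mk hx)]
      rfl
    · rw [f.2 x hx, mul_zero]
      change 0 = star (f.1 x) * f.1 x
      rw [f.2 x hx, mul_zero]
  refine ⟨Real.sqrt ‖star f.1 * f.1‖, ?_⟩
  rintro _ ⟨p, rfl⟩
  refine Real.le_sqrt_of_sq_le ?_
  change p (Alg.sym θ k f) ^ 2 ≤ _
  rw [← p.star_mul_self', h]
  exact p.apply_le_norm (incl θ) _

theorem bddAbove (a : Alg θ) :
    BddAbove (Set.range fun p : CStarSeminorm (Alg θ) => p a) := by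
  refine Alg.ind (P := fun a => BddAbove (Set.range fun p : CStarSeminorm (Alg θ) => p a)) ?_
    (fun k f => bddAbove_sym f) ?_ a
  · refine ⟨0, ?_⟩
    rintro _ ⟨p, rfl⟩
    exact (map_zero p.toSeminorm).le
  · rintro a b ⟨A, hA⟩ ⟨B, hB⟩
    refine ⟨A + B, ?_⟩
    rintro _ ⟨p, rfl⟩
    exact (map_add_le_add p.toSeminorm a b).trans (add_le_add (hA ⟨p, rfl⟩) (hB ⟨p, rfl⟩))

end

end PartialAut

/-- The crossed product of `C₀(X)` by a partial automorphism `θ`: the universal C⋆-envelope of the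
⋆-algebra of finite sums of symbols `s ^ k f`. -/
abbrev CrossedProduct {X : Type*} [TopologicalSpace X] [T2Space X]
    (θ : OpenPartialHomeomorph X X) : Type _ :=
  (CStarSeminorm.universal (PartialAut.bddAbove (θ := θ))).Completion

/-- The canonical ⋆-homomorphism to the crossed product. -/
noncomputable def CrossedProduct.of {X : Type*} [TopologicalSpace X] [T2Space X]
    (θ : OpenPartialHomeomorph X X) : PartialAut.Alg θ →⋆ₙₐ[ℂ] CrossedProduct θ :=
  CStarSeminorm.Completion.ofHom _

/-- The element `s ^ k f` of the crossed product. -/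
noncomputable def CrossedProduct.sym {X : Type*} [TopologicalSpace X] [T2Space X]
    (θ : OpenPartialHomeomorph X X) (k : ℤ) (f : PartialAut.N θ k) : CrossedProduct θ :=
  CrossedProduct.of θ (PartialAut.Alg.sym θ k f)

/-! ### Restriction to the fibres of an invariant map -/

namespace PartialAut

noncomputable section

variable {X Y : Type*} [TopologicalSpace X] [TopologicalSpace Y]
  {θ : OpenPartialHomeomorph X X} {π : X → Y}

theorem symm_invariant (hθ : ∀ x ∈ θ.source, π (θ x) = π x) :
    ∀ x ∈ θ.target, π (θ.symm x) = π x := fun x hx => by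
  rw [← hθ _ (θ.map_target hx), θ.right_inv hx]

open scoped Classical in
/-- The restriction of a partial automorphism `θ` with `π ∘ θ = π` to the fibre of `π` over `y`. -/
def fiber (θ : OpenPartialHomeomorph X X) (hθ : ∀ x ∈ θ.source, π (θ x) = π x) (y : Y) :
    OpenPartialHomeomorph (π ⁻¹' {y}) (π ⁻¹' {y}) where
  toFun x := if h : x.1 ∈ θ.source then ⟨θ x.1, (hθ x.1 h).trans x.2⟩ else x
  invFun x := if h : x.1 ∈ θ.target then ⟨θ.symm x.1, (symm_invariant hθ x.1 h).trans x.2⟩ else x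
  source := Subtype.val ⁻¹' θ.source
  target := Subtype.val ⁻¹' θ.target
  map_source' x hx := by
    have hx : x.1 ∈ θ.source := hx
    rw [dif_pos hx]
    exact θ.map_source hx
  map_target' x hx := by
    have hx : x.1 ∈ θ.target := hx
    rw [dif_pos hx]
    exact θ.map_target hx
  left_inv' x hx := by
    have hx : x.1 ∈ θ.source := hx
    rw [dif_pos hx, dif_pos (θ.map_source hx)]
    exact Subtype.ext (θ.left_inv hx)
  right_inv' x hx := by
    have hx : x.1 ∈ θ.target := hx
    rw [dif_pos hx, dif_pos (θ.map_target hx)]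
    exact Subtype.ext (θ.right_inv hx)
  continuousOn_toFun := by
    rw [continuousOn_iff_continuous_domRestrict, continuous_induced_rng]
    have h1 : Continuous fun x : (Subtype.val ⁻¹' θ.source : Set (π ⁻¹' {y})) => θ x.1.1 :=
      θ.continuousOn.comp_continuous (by fun_prop) fun x => x.2
    refine h1.congr fun x => ?_
    have hx : x.1.1 ∈ θ.source := x.2
    simp [hx]
  continuousOn_invFun := by
    rw [continuousOn_iff_continuous_domRestrict, continuous_induced_rng]
    have h1 : Continuous fun x : (Subtype.val ⁻¹' θ.target : Set (π ⁻¹' {y})) => θ.symm x.1.1 :=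
      θ.continuousOn_symm.comp_continuous (by fun_prop) fun x => x.2
    refine h1.congr fun x => ?_
    have hx : x.1.1 ∈ θ.target := x.2
    simp [hx]
  open_source := θ.open_source.preimage continuous_subtype_val
  open_target := θ.open_target.preimage continuous_subtype_val

variable (hθ : ∀ x ∈ θ.source, π (θ x) = π x)

theorem fiber_rel_nat (y : Y) (n : ℕ) (x : π ⁻¹' {y}) (z : X) (h : Rel θ n x.1 z) :
    ∃ hz : z ∈ π ⁻¹' {y}, Rel (fiber θ hθ y) n x ⟨z, hz⟩ := by
  induction n generalizing z with
  | zero =>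
    obtain rfl := rel_zero.1 h
    exact ⟨x.2, rel_zero.2 rfl⟩
  | succ n ih =>
    obtain ⟨w, hw, hs, rfl⟩ := rel_natSucc.1 h
    obtain ⟨hw', hr⟩ := ih w hw
    exact ⟨(hθ w hs).trans hw', rel_natSucc.2 ⟨_, hr, hs, dif_pos hs⟩⟩

theorem invariant_nat (hθ : ∀ x ∈ θ.source, π (θ x) = π x) (n : ℕ) (x z : X)
    (h : Rel θ n x z) : π z = π x :=
  (fiber_rel_nat hθ (π x) n ⟨x, rfl⟩ z h).1

/-- The domain of `θ ^ k`, intersected with a fibre, lies in the domain of the `k`-th power of the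
restriction of `θ` to this fibre. -/
theorem mem_source_fiber (y : Y) (k : ℤ) (x : π ⁻¹' {y}) (h : x.1 ∈ (zpow θ k).source) :
    x ∈ (zpow (fiber θ hθ y) k).source := by
  rcases k with n | n
  · exact (fiber_rel_nat hθ y n x _ (Rel.mk h)).2.1
  · have h2 : Rel θ (n + 1 : ℕ) (zpow θ (Int.negSucc n) x.1) x.1 := rel_neg.1 (Rel.mk h)
    have h3 : zpow θ (Int.negSucc n) x.1 ∈ π ⁻¹' {y} :=
      (invariant_nat hθ _ _ _ h2).symm.trans x.2
    obtain ⟨_, h4⟩ := fiber_rel_nat hθ y (n + 1) ⟨_, h3⟩ x.1 h2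
    exact (rel_neg.2 h4 : Rel (fiber θ hθ y) (-((n + 1 : ℕ) : ℤ)) x _).1

/-- The restriction of a function in `C₀(X)` to a fibre of `π`. -/
def restrict [T1Space Y] (hπ : Continuous π) (y : Y) (f : C₀(X, ℂ)) : C₀(π ⁻¹' {y}, ℂ) :=
  f.comp
    { toFun := Subtype.val
      continuous_toFun := continuous_subtype_val
      cocompact_tendsto' :=
        (isClosed_singleton.preimage hπ).isClosedEmbedding_subtypeVal.tendsto_cocompact }

/-- The restriction of a symbol `s ^ k f` to a fibre of `π`. -/
def restrictN [T1Space Y] (hπ : Continuous π) (y : Y) {k : ℤ} (f : N θ k) :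
    N (fiber θ hθ y) k :=
  ⟨restrict hπ y f.1, fun x hx => f.2 x.1 fun h => hx (mem_source_fiber hθ y k x h)⟩

/-- The function `(g ∘ π) f` in `C₀(X)`. -/
def baseMul (hπ : Continuous π) (g : C₀(Y, ℂ)) (f : C₀(X, ℂ)) : C₀(X, ℂ) where
  toFun x := g (π x) * f x
  continuous_toFun := ((map_continuous g).comp hπ).mul (map_continuous f)
  zero_at_infty' := by
    have h := (zero_at_infty f).norm.const_mul ‖g.toBCF‖
    rw [norm_zero, mul_zero] at h
    refine squeeze_zero_norm (fun x => ?_) h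
    rw [norm_mul]
    exact mul_le_mul_of_nonneg_right (g.toBCF.norm_coe_le_norm (π x)) (norm_nonneg _)

/-- The symbol `s ^ k ((g ∘ π) f)`. -/
def baseMulN (hπ : Continuous π) (g : C₀(Y, ℂ)) {k : ℤ} (f : N θ k) : N θ k :=
  ⟨baseMul hπ g f.1, fun x hx => by
    change g (π x) * f.1 x = 0
    rw [f.2 x hx, mul_zero]⟩

end

end PartialAut

/-! ### `C₀(Y)`-algebras, their localisations, and continuous fields -/

/-- A `C₀(Y)`-algebra structure on a C⋆-algebra `A`: an injective nondegenerate ⋆-homomorphism of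
`C₀(Y)` into the centre of the multiplier algebra of `A`. -/
structure C0Algebra (Y : Type*) [TopologicalSpace Y] (A : Type*) [NonUnitalCStarAlgebra A] where
  hom : C₀(Y, ℂ) →⋆ₙₐ[ℂ] 𝓜(ℂ, A)
  injective : Function.Injective hom
  central : ∀ (g : C₀(Y, ℂ)) (m : 𝓜(ℂ, A)), hom g * m = m * hom g
  nondegenerate :
    (Submodule.span ℂ {b : A | ∃ (g : C₀(Y, ℂ)) (a : A), (hom g).fst a = b}).topologicalClosure = ⊤

namespace C0Algebra

noncomputable section

variable {Y : Type*} [TopologicalSpace Y] {A : Type*} [NonUnitalCStarAlgebra A]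
  (S : C0Algebra Y A)

theorem eq_of_mul_left {a b : A} (h : ∀ x, x * a = x * b) : a = b := by
  rw [← sub_eq_zero, ← CStarRing.star_mul_self_eq_zero_iff, mul_sub, h, sub_self]

theorem eq_of_mul_right {a b : A} (h : ∀ x, a * x = b * x) : a = b := by
  rw [← sub_eq_zero, ← CStarRing.mul_star_self_eq_zero_iff, sub_mul, h, sub_self]

theorem fst_mul (g : C₀(Y, ℂ)) (a b : A) : (S.hom g).fst (a * b) = (S.hom g).fst a * b :=
  eq_of_mul_left fun x => by
    rw [← (S.hom g).central, ← mul_assoc, (S.hom g).central, mul_assoc]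

theorem snd_eq_fst (g : C₀(Y, ℂ)) (a : A) : (S.hom g).snd a = (S.hom g).fst a := by
  have h := congrArg (fun m : 𝓜(ℂ, A) => m.fst) (S.central g (a : 𝓜(ℂ, A)))
  refine eq_of_mul_right fun x => ?_
  have h2 := congrArg (fun T : A →L[ℂ] A => T x) h
  simp only [DoubleCentralizer.mul_fst, DoubleCentralizer.coe_fst] at h2
  change (S.hom g).fst (a * x) = a * (S.hom g).fst x at h2
  rw [(S.hom g).central, ← h2, S.fst_mul]

theorem mul_fst (g : C₀(Y, ℂ)) (a b : A) : a * (S.hom g).fst b = (S.hom g).fst (a * b) := by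
  rw [← (S.hom g).central, S.snd_eq_fst, S.fst_mul]

theorem star_fst (g : C₀(Y, ℂ)) (a : A) : star ((S.hom g).fst a) = (S.hom (star g)).fst (star a) := by
  rw [map_star S.hom, DoubleCentralizer.star_fst, star_star, S.snd_eq_fst]

/-- The closed ideal `C₀(Y ∖ {y}) A` of `A`. -/
def ideal (y : Y) : Submodule ℂ A :=
  (Submodule.span ℂ
    {b : A | ∃ (g : C₀(Y, ℂ)) (a : A), g y = 0 ∧ (S.hom g).fst a = b}).topologicalClosure

instance isClosed_ideal (y : Y) : IsClosed (S.ideal y : Set A) :=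
  Submodule.isClosed_topologicalClosure _

variable {S} in
theorem mem_ideal (y : Y) {g : C₀(Y, ℂ)} (hg : g y = 0) (a : A) : (S.hom g).fst a ∈ S.ideal y :=
  Submodule.le_topologicalClosure _ (Submodule.subset_span ⟨g, a, hg, rfl⟩)

theorem ideal_map {y : Y} (T : A →+ A) (hT : Continuous T) (σ : ℂ → ℂ)
    (hσ : ∀ c a, T (c • a) = σ c • T a)
    (h : ∀ (g : C₀(Y, ℂ)) (a : A), g y = 0 → T ((S.hom g).fst a) ∈ S.ideal y)
    {a : A} (ha : a ∈ S.ideal y) : T a ∈ S.ideal y := by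
  have hc : IsClosed {a | T a ∈ S.ideal y} := (S.isClosed_ideal y).preimage hT
  refine closure_minimal (fun b hb => ?_) hc ha
  refine Submodule.span_induction ?_ ?_ ?_ ?_ hb
  · rintro _ ⟨g, a, hg, rfl⟩
    exact h g a hg
  · change T 0 ∈ S.ideal y
    rw [map_zero]
    exact zero_mem _
  · intro a b _ _ ha hb
    change T (a + b) ∈ S.ideal y
    rw [map_add]
    exact add_mem ha hb
  · intro c a _ ha
    change T (c • a) ∈ S.ideal y
    rw [hσ]
    exact Submodule.smul_mem _ _ ha

theorem mul_mem_left {y : Y} (b : A) {a : A} (ha : a ∈ S.ideal y) : b * a ∈ S.ideal y :=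
  S.ideal_map (AddMonoidHom.mulLeft b) (continuous_const.mul continuous_id) id
    (fun c a => mul_smul_comm c b a)
    (fun g a hg => by
      change b * _ ∈ S.ideal y
      rw [S.mul_fst]
      exact mem_ideal y hg _) ha

theorem mul_mem_right {y : Y} (b : A) {a : A} (ha : a ∈ S.ideal y) : a * b ∈ S.ideal y :=
  S.ideal_map (AddMonoidHom.mulRight b) (continuous_id.mul continuous_const) id
    (fun c a => smul_mul_assoc c a b)
    (fun g a hg => by
      change _ * b ∈ S.ideal y
      rw [← S.fst_mul]
      exact mem_ideal y hg _) ha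

theorem star_mem {y : Y} {a : A} (ha : a ∈ S.ideal y) : star a ∈ S.ideal y :=
  S.ideal_map (starAddEquiv : A ≃+ A).toAddMonoidHom continuous_star star
    (fun c a => star_smul c a)
    (fun g a hg => by
      change star _ ∈ S.ideal y
      rw [S.star_fst]
      refine mem_ideal y ?_ _
      rw [ZeroAtInftyContinuousMap.star_apply, hg, star_zero]) ha

/-- The localisation `A_y`: the quotient of `A` by the closed ideal `C₀(Y ∖ {y}) A`, with the
quotient norm and the induced ⋆-algebra structure. -/
def Fiber (y : Y) : Type _ := A ⧸ S.ideal y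

/-- The image `a_y` of `a` in the localisation at `y`. -/
def loc (y : Y) (a : A) : S.Fiber y := Submodule.Quotient.mk a

namespace Fiber

variable {S} {y : Y}

instance : NormedAddCommGroup (S.Fiber y) := inferInstanceAs (NormedAddCommGroup (A ⧸ S.ideal y))

instance : NormedSpace ℂ (S.Fiber y) := inferInstanceAs (NormedSpace ℂ (A ⧸ S.ideal y))

instance : CompleteSpace (S.Fiber y) := inferInstanceAs (CompleteSpace (A ⧸ S.ideal y))

theorem loc_eq {a b : A} : S.loc y a = S.loc y b ↔ a - b ∈ S.ideal y := Submodule.Quotient.eq _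

theorem loc_surjective : Function.Surjective (S.loc y) := Submodule.Quotient.mk_surjective _

theorem norm_loc (a : A) : ‖S.loc y a‖ = Metric.infDist a (S.ideal y) :=
  QuotientAddGroup.norm_mk (S := (S.ideal y).toAddSubgroup) a

instance : Mul (S.Fiber y) where
  mul := Quotient.map₂ (· * ·) fun a a' h b b' h' => by
    have h1 : a - a' ∈ S.ideal y := (Submodule.quotientRel_def _).1 h
    have h2 : b - b' ∈ S.ideal y := (Submodule.quotientRel_def _).1 h'
    refine (Submodule.quotientRel_def _).2 ?_
    have : a * b - a' * b' = (a - a') * b + a' * (b - b') := by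
      rw [sub_mul, mul_sub]; abel
    rw [this]
    exact add_mem (S.mul_mem_right b h1) (S.mul_mem_left a' h2)

instance : Star (S.Fiber y) where
  star := Quotient.map star fun a b h => by
    have h1 : a - b ∈ S.ideal y := (Submodule.quotientRel_def _).1 h
    refine (Submodule.quotientRel_def _).2 ?_
    rw [← star_sub]
    exact S.star_mem h1

theorem loc_mul (a b : A) : S.loc y (a * b) = S.loc y a * S.loc y b := rfl

theorem loc_add (a b : A) : S.loc y (a + b) = S.loc y a + S.loc y b := rfl

theorem loc_zero : S.loc y 0 = 0 := rfl

theorem loc_smul (c : ℂ) (a : A) : S.loc y (c • a) = c • S.loc y a := rfl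

theorem loc_star (a : A) : S.loc y (star a) = star (S.loc y a) := rfl

instance : NonUnitalRing (S.Fiber y) where
  __ := (inferInstance : AddCommGroup (S.Fiber y))
  left_distrib := loc_surjective.forall₃.2 fun a b c => by
    simp only [← loc_mul, ← loc_add, mul_add]
  right_distrib := loc_surjective.forall₃.2 fun a b c => by
    simp only [← loc_mul, ← loc_add, add_mul]
  zero_mul := loc_surjective.forall.2 fun a => by rw [← loc_zero, ← loc_mul, zero_mul]
  mul_zero := loc_surjective.forall.2 fun a => by rw [← loc_zero, ← loc_mul, mul_zero]
  mul_assoc := loc_surjective.forall₃.2 fun a b c => by simp only [← loc_mul, mul_assoc]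

instance : StarRing (S.Fiber y) where
  star_involutive := loc_surjective.forall.2 fun a => by simp only [← loc_star, star_star]
  star_mul := loc_surjective.forall₂.2 fun a b => by simp only [← loc_star, ← loc_mul, star_mul]
  star_add := loc_surjective.forall₂.2 fun a b => by simp only [← loc_star, ← loc_add, star_add]

end Fiber

/-- A `C₀(Y)`-algebra `A` is a continuous field of C⋆-algebras over `Y` if `y ↦ ‖a_y‖` is
continuous for every `a` in `A`. -/
def IsContinuousField : Prop := ∀ a : A, Continuous fun y => ‖S.loc y a‖

end

end C0Algebra

/-! The proof computes the universal norm by explicit representations. A point $x$ of $H$ gives a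
representation `orbitRep` on $\ell^2(\mathbb Z)$, in which $s^kf$ sends $\delta_n$ to
$f(\theta^nx)\,\delta_{n+k}$, read as $0$ if $\theta^nx$ is undefined. The index is the exponent $n$
and not the point $\theta^nx$, so the coefficients of $a=\sum_k s^kf_k$ remain visible at periodic
points: $f_k(x)=\langle\delta_k,a\delta_0\rangle$.

The main tool is `Alg.eventually_le_of_coeff`. Every C⋆-seminorm $p$ satisfies $p(s^kf)\le\|f\|$, so
a bound on coefficients bounds $p(a)$ up to the factor $2M+1$, where $M$ is the degree of $a$.
Replacing $a$ by the $n$-th iterate of $a\mapsto a^*a$ raises $p(a)$ to the power $2^n$, while the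
degree is at most $2^nM$; taking $2^n$-th roots makes the factor disappear. Applied to the supremum
of the orbit norms, this shows that the supremum is the universal norm (`universalNorm_le`).

The restrictions of $a$ to the fibres $H_y$ have universal norms `fiberNorm`, each the supremum of
the orbit norms over $x\in H_y$. Their continuity in $y$ (`continuous_fiberNorm`) has two halves.
Each orbit norm is lower semicontinuous in $x$, because it can be tested on finitely many $\delta_n$
for which $\theta^n$ is defined near $x$ (`eventually_lt_orbitNorm`); openness of $\pi$ carries this
to $Y$. Upper semicontinuity is the root argument again, now asymptotically as $z\to y$: it reduces
to single coefficients, where it holds because $\{|f|\ge\varepsilon\}$ is compact.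

A function $g\circ\pi$ is constant on orbits, so it acts in each orbit representation as a scalar.
Hence multiplication by $g\circ\pi$ is bounded and central. Restriction to $H_y$ kills the ideal at
$y$. Conversely, $a$ may be multiplied by a cutoff $\chi\circ\pi$ with $\chi(y)=1$ without changing
$a_y$; by continuity of the fibre norms a cutoff concentrated near $y$ gives
$\|a_y\|\le\|a|_{H_y}\|+\varepsilon$ (`norm_loc_of_le`). So restriction induces an isometry on
$A_y$, and the Tietze theorem gives it dense, hence full, range. -/

namespace PartialAut

noncomputable section

variable {X : Type*} [TopologicalSpace X] [T2Space X] {θ : OpenPartialHomeomorph X X}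

namespace Alg

/-! ### Coefficients and degrees in the ⋆-algebra of a partial automorphism -/

/-- The coefficient of `s ^ k` in an element of the ⋆-algebra. -/
def coeff (k : ℤ) : Alg θ →ₗ[ℂ] N θ k := DirectSum.component ℂ ℤ (fun k => N θ k) k

theorem coeff_sym_self (k : ℤ) (f : N θ k) : coeff k (sym θ k f) = f :=
  DFinsupp.single_eq_same (β := fun k : ℤ => N θ k)

theorem coeff_sym_of_ne {k l : ℤ} (h : l ≠ k) (f : N θ l) : coeff k (sym θ l f) = 0 :=
  DFinsupp.single_eq_of_ne (β := fun k : ℤ => N θ k) h.symm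

theorem ext_coeff {a b : Alg θ} (h : ∀ k, coeff k a = coeff k b) : a = b :=
  DFinsupp.ext h

/-- The linear map on the ⋆-algebra given by linear maps on the symbols. -/
def lift {B : Type*} [AddCommMonoid B] [Module ℂ B] (φ : ∀ k : ℤ, N θ k →ₗ[ℂ] B) : Alg θ →ₗ[ℂ] B :=
  DirectSum.toModule ℂ ℤ B φ

theorem lift_sym {B : Type*} [AddCommMonoid B] [Module ℂ B] (φ : ∀ k : ℤ, N θ k →ₗ[ℂ] B) (k : ℤ)
    (f : N θ k) : lift φ (sym θ k f) = φ k f :=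
  DirectSum.toModule_lof (M := fun k : ℤ => N θ k) ℂ k f

/-- The ⋆-homomorphism given by linear maps `φ k` on the symbols that respect products and
adjoints of symbols. -/
def liftHom {B : Type*} [NonUnitalNonAssocRing B] [StarRing B] [Module ℂ B]
    (φ : ∀ k : ℤ, N θ k →ₗ[ℂ] B)
    (hmul : ∀ (k l : ℤ) (f : N θ k) (g : N θ l), φ (k + l) (mulN f g) = φ k f * φ l g)
    (hstar : ∀ (k : ℤ) (f : N θ k), φ (-k) (starN f) = star (φ k f)) : Alg θ →⋆ₙₐ[ℂ] B where
  __ := lift φ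
  map_zero' := map_zero (lift φ)
  map_mul' a b := by
    change lift φ (a * b) = lift φ a * lift φ b
    refine ind (P := fun a => lift φ (a * b) = lift φ a * lift φ b) (by simp) (fun k f => ?_)
      (fun a a' h h' => by rw [add_mul, map_add, map_add, add_mul, h, h']) a
    refine ind (P := fun b => lift φ (sym θ k f * b) = lift φ (sym θ k f) * lift φ b) (by simp)
      (fun l g => ?_) (fun a a' h h' => by rw [mul_add, map_add, map_add, mul_add, h, h']) b
    rw [sym_mul_sym, lift_sym, lift_sym, lift_sym, hmul]
  map_star' a := by
    change lift φ (star a) = star (lift φ a)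
    refine ind (P := fun a => lift φ (star a) = star (lift φ a)) (by simp) (fun k f => ?_)
      (fun a a' h h' => by rw [star_add, map_add, map_add, star_add, h, h']) a
    rw [star_sym, lift_sym, lift_sym, hstar]

theorem liftHom_sym {B : Type*} [NonUnitalNonAssocRing B] [StarRing B] [Module ℂ B]
    (φ : ∀ k : ℤ, N θ k →ₗ[ℂ] B) (hmul hstar) (k : ℤ) (f : N θ k) :
    liftHom φ hmul hstar (sym θ k f) = φ k f := lift_sym φ k f

/-- The elements of the ⋆-algebra whose coefficients vanish outside `[-M, M]`. -/
def degreeLE (θ : OpenPartialHomeomorph X X) (M : ℕ) : Submodule ℂ (Alg θ) where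
  carrier := {a | ∀ k : ℤ, M < k.natAbs → coeff k a = 0}
  add_mem' ha hb k hk := by rw [map_add, ha k hk, hb k hk, add_zero]
  zero_mem' k _ := map_zero _
  smul_mem' c a ha k hk := by rw [map_smul, ha k hk, smul_zero]

theorem sym_mem_degreeLE {k : ℤ} {M : ℕ} (hk : k.natAbs ≤ M) (f : N θ k) :
    sym θ k f ∈ degreeLE θ M := fun l hl => by
  refine coeff_sym_of_ne ?_ f
  rintro rfl
  omega

theorem eq_sum_of_mem_degreeLE {M : ℕ} {a : Alg θ} (ha : a ∈ degreeLE θ M) :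
    a = ∑ k ∈ Finset.Icc (-(M : ℤ)) M, sym θ k (coeff k a) := by
  refine ext_coeff fun l => ?_
  rw [map_sum]
  by_cases hl : l ∈ Finset.Icc (-(M : ℤ)) M
  · rw [Finset.sum_eq_single_of_mem l hl fun k _ hk => coeff_sym_of_ne hk _, coeff_sym_self]
  · rw [Finset.sum_eq_zero fun k hk => coeff_sym_of_ne (ne_of_mem_of_not_mem hk hl) _]
    refine ha l ?_
    rw [Finset.mem_Icc] at hl
    omega

theorem exists_mem_degreeLE (a : Alg θ) : ∃ M, a ∈ degreeLE θ M := by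
  refine ind (P := fun a => ∃ M, a ∈ degreeLE θ M) ⟨0, zero_mem _⟩
    (fun k f => ⟨_, sym_mem_degreeLE le_rfl f⟩) ?_ a
  rintro a b ⟨M, hM⟩ ⟨L, hL⟩
  refine ⟨max M L, fun k hk => ?_⟩
  rw [map_add, hM k (lt_of_le_of_lt (le_max_left _ _) hk),
    hL k (lt_of_le_of_lt (le_max_right _ _) hk), add_zero]

theorem mul_mem_degreeLE {M L : ℕ} {a b : Alg θ} (ha : a ∈ degreeLE θ M)
    (hb : b ∈ degreeLE θ L) : a * b ∈ degreeLE θ (M + L) := by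
  rw [eq_sum_of_mem_degreeLE ha, eq_sum_of_mem_degreeLE hb, Finset.sum_mul_sum]
  refine sum_mem fun k hk => sum_mem fun l hl => ?_
  rw [sym_mul_sym]
  rw [Finset.mem_Icc] at hk hl
  exact sym_mem_degreeLE (by omega) _

theorem star_mem_degreeLE {M : ℕ} {a : Alg θ} (ha : a ∈ degreeLE θ M) :
    star a ∈ degreeLE θ M := by
  rw [eq_sum_of_mem_degreeLE ha, star_sum]
  refine sum_mem fun k hk => ?_
  rw [star_sym]
  rw [Finset.mem_Icc] at hk
  exact sym_mem_degreeLE (by omega) _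

/-! ### Comparison of C⋆-seminorms -/

/-- The iterates of `a ↦ a⋆ a`. -/
def sqIter (a : Alg θ) : ℕ → Alg θ
  | 0 => a
  | n + 1 => star (sqIter a n) * sqIter a n

theorem apply_sqIter (p : CStarSeminorm (Alg θ)) (a : Alg θ) (n : ℕ) :
    p (sqIter a n) = p a ^ 2 ^ n := by
  induction n with
  | zero => simp [sqIter]
  | succ n ih =>
    change p (star (sqIter a n) * sqIter a n) = _
    rw [p.star_mul_self', ih, ← pow_mul, pow_succ]

theorem sqIter_le {r : Alg θ → ℝ} (hr0 : ∀ a, 0 ≤ r a) (hr : ∀ a, r (star a * a) ≤ r a ^ 2)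
    (a : Alg θ) (n : ℕ) : r (sqIter a n) ≤ r a ^ 2 ^ n := by
  induction n with
  | zero => simp [sqIter]
  | succ n ih =>
    calc r (sqIter a (n + 1)) ≤ r (sqIter a n) ^ 2 := hr _
      _ ≤ (r a ^ 2 ^ n) ^ 2 := pow_le_pow_left₀ (hr0 _) ih 2
      _ = _ := by rw [← pow_mul, pow_succ]

/-- The degree bound doubles at each step, as does the exponent in `apply_sqIter`. The number of
coefficients is therefore at most linear in that exponent. -/
theorem sqIter_mem_degreeLE {M : ℕ} {a : Alg θ} (ha : a ∈ degreeLE θ M) (n : ℕ) :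
    sqIter a n ∈ degreeLE θ (2 ^ n * M) := by
  induction n with
  | zero => simpa [sqIter] using ha
  | succ n ih =>
    have := mul_mem_degreeLE (star_mem_degreeLE ih) ih
    rwa [← two_mul, ← mul_assoc, ← pow_succ'] at this

theorem exists_linear_mul_pow_le {d c : ℝ} (hd : 0 < d) (hdc : d < c) (M : ℕ) :
    ∃ n : ℕ, (2 * ((2 ^ n * M : ℕ) : ℝ) + 1) * d ^ 2 ^ n ≤ c ^ 2 ^ n := by
  have h1 : 1 < c / d := (one_lt_div hd).2 hdc
  have h2 : Filter.Tendsto (fun n : ℕ => (2 * (n : ℝ) ^ 1 / (c / d) ^ n * M)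
      + 1 / (c / d) ^ n) Filter.atTop (nhds 0) := by
    have h3 := tendsto_pow_const_div_const_pow_of_one_lt 1 h1
    have h4 := tendsto_pow_const_div_const_pow_of_one_lt 0 h1
    have h5 := (h3.const_mul (2 * (M : ℝ))).add h4
    simp only [mul_zero, add_zero, pow_zero] at h5
    refine h5.congr fun n => ?_
    ring
  -- Exponential growth beats linear growth along all exponents; only the exponents that are powers
  -- of two are needed.
  have h6 := h2.comp (tendsto_pow_atTop_atTop_of_one_lt (one_lt_two : (1 : ℕ) < 2))
  obtain ⟨n, hn⟩ := (h6.eventually_le_const zero_lt_one).exists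
  refine ⟨n, ?_⟩
  have h7 : 0 < (c / d) ^ 2 ^ n := pow_pos (one_pos.trans h1) _
  have h8 : (2 * ((2 ^ n * M : ℕ) : ℝ) + 1) / (c / d) ^ 2 ^ n ≤ 1 := by
    refine le_trans (le_of_eq ?_) hn
    simp only [Function.comp_apply]
    push_cast
    ring
  rw [div_le_one h7, div_pow] at h8
  rwa [le_div_iff₀ (pow_pos hd _)] at h8

theorem apply_sum_le (p : CStarSeminorm (Alg θ)) {ι : Type*} (s : Finset ι) (a : ι → Alg θ) :
    p (∑ i ∈ s, a i) ≤ ∑ i ∈ s, p (a i) :=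
  Finset.le_sum_of_subadditive _ (map_zero p.toSeminorm).le (map_add_le_add p.toSeminorm) s a

/-- A C⋆-seminorm is dominated by every function `r` with `r (a⋆ a) ≤ r a ^ 2` that dominates it
on coefficients, because the number of coefficients of a power grows only linearly. The statement
is for a family of C⋆-seminorms, asymptotically along a filter. -/
theorem eventually_le_of_coeff {ι : Type*} {F : Filter ι} {p : ι → CStarSeminorm (Alg θ)}
    {r : Alg θ → ℝ} (hr0 : ∀ a, 0 ≤ r a) (hr : ∀ a, r (star a * a) ≤ r a ^ 2)
    (h : ∀ (b : Alg θ) (k : ℤ), ∀ ε > 0, ∀ᶠ i in F, p i (sym θ k (coeff k b)) ≤ r b + ε)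
    (a : Alg θ) {c : ℝ} (hc : r a < c) : ∀ᶠ i in F, p i a ≤ c := by
  obtain ⟨M, hM⟩ := exists_mem_degreeLE a
  obtain ⟨d, hd, hdc⟩ := exists_between hc
  have hd0 : 0 < d := (hr0 a).trans_lt hd
  -- The iterate is fixed before the index of the family, so only finitely many coefficient
  -- conditions are imposed along the filter.
  obtain ⟨n, hn⟩ := exists_linear_mul_pow_le hd0 hdc M
  have hdeg := sqIter_mem_degreeLE hM n
  -- This gap is the error allowed in each coefficient: it turns the bound by `r` of the iterate,
  -- plus the error, into a bound by `d ^ 2 ^ n`.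
  have hε : 0 < d ^ 2 ^ n - r a ^ 2 ^ n :=
    sub_pos.2 (pow_lt_pow_left₀ hd (hr0 a) (by positivity))
  have hev := (Filter.eventually_all_finset
    (Finset.Icc (-((2 ^ n * M : ℕ) : ℤ)) (2 ^ n * M : ℕ))).2
    fun k _ => h (sqIter a n) k _ hε
  filter_upwards [hev] with i hi
  refine le_of_pow_le_pow_left₀ (n := 2 ^ n) (by positivity) (hd0.trans hdc).le ?_
  rw [← apply_sqIter]
  conv_lhs => rw [eq_sum_of_mem_degreeLE hdeg]
  calc _ ≤ _ := apply_sum_le (p i) _ _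
    _ ≤ ∑ k ∈ Finset.Icc (-((2 ^ n * M : ℕ) : ℤ)) (2 ^ n * M : ℕ), d ^ 2 ^ n :=
      Finset.sum_le_sum fun k hk => (hi k hk).trans (by
        have := sqIter_le hr0 hr a n
        linarith)
    _ = (2 * ((2 ^ n * M : ℕ) : ℝ) + 1) * d ^ 2 ^ n := by
      rw [Finset.sum_const, nsmul_eq_mul, Int.card_Icc]
      congr 1
      have : ((2 ^ n * M : ℕ) + 1 - -((2 ^ n * M : ℕ) : ℤ)).toNat = 2 * (2 ^ n * M) + 1 := by
        omega
      rw [this]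
      push_cast
      ring
    _ ≤ _ := hn

/-- The case of a constant family, indexed by a point. -/
theorem le_of_coeff {p : CStarSeminorm (Alg θ)} {r : Alg θ → ℝ} (hr0 : ∀ a, 0 ≤ r a)
    (hr : ∀ a, r (star a * a) ≤ r a ^ 2) (h : ∀ b k, p (sym θ k (coeff k b)) ≤ r b)
    (a : Alg θ) : p a ≤ r a := by
  refine le_of_forall_gt_imp_ge_of_dense fun c hc => ?_
  have := eventually_le_of_coeff (F := (⊤ : Filter Unit)) (p := fun _ => p) hr0 hr
    (fun b k ε hε => Filter.Eventually.of_forall fun _ => by have := h b k; linarith) a hc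
  exact Filter.eventually_top.1 this ()

end Alg

end

end PartialAut

/-! ### Weighted shifts -/

noncomputable section WeightedShift

/-- The Hilbert space `ℓ²(ℤ)`. -/
abbrev SeqSpace : Type := lp (fun _ : ℤ => ℂ) 2

namespace SeqSpace

theorem summable_sq (ξ : SeqSpace) : Summable fun m => ‖ξ m‖ ^ 2 := by
  simpa using (lp.memℓp ξ).summable (by simp)

theorem norm_sq_eq (ξ : SeqSpace) : ‖ξ‖ ^ 2 = ∑' m, ‖ξ m‖ ^ 2 := by
  simpa using lp.norm_rpow_eq_tsum (p := 2) (by simp) ξ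

variable {w : ℤ → ℂ} {C : ℝ}

theorem weighted_sq_le (hw : ∀ n, ‖w n‖ ≤ C) (k : ℤ) (ξ : SeqSpace) (m : ℤ) :
    ‖w (m - k) * ξ (m - k)‖ ^ 2 ≤ C ^ 2 * ‖ξ (m - k)‖ ^ 2 := by
  rw [norm_mul, mul_pow]
  exact mul_le_mul_of_nonneg_right (pow_le_pow_left₀ (norm_nonneg _) (hw _) 2) (sq_nonneg _)

theorem summable_shift (C : ℝ) (k : ℤ) (ξ : SeqSpace) :
    Summable fun m => C ^ 2 * ‖ξ (m - k)‖ ^ 2 :=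
  ((Equiv.subRight k).summable_iff.2 ξ.summable_sq).mul_left _

/-- The operator `ξ ↦ (m ↦ w (m - k) ξ (m - k))` on `ℓ²(ℤ)`, for a bounded weight `w`. -/
def weightedShift (w : ℤ → ℂ) (C : ℝ) (hw : ∀ n, ‖w n‖ ≤ C) (k : ℤ) : SeqSpace →L[ℂ] SeqSpace :=
  LinearMap.mkContinuous
    { toFun := fun ξ => (⟨fun m => w (m - k) * ξ (m - k), by
        refine memℓp_gen ?_
        simpa using Summable.of_nonneg_of_le (fun _ => sq_nonneg _)
          (weighted_sq_le hw k ξ) (summable_shift C k ξ)⟩ : SeqSpace)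
      map_add' := fun ξ η => by
        ext m
        change w (m - k) * (ξ (m - k) + η (m - k)) = _
        rw [mul_add]
        rfl
      map_smul' := fun c ξ => by
        ext m
        exact mul_left_comm _ _ _ }
    C fun ξ => by
      have hC : 0 ≤ C := (norm_nonneg _).trans (hw 0)
      refine le_of_pow_le_pow_left₀ two_ne_zero (by positivity) ?_
      rw [norm_sq_eq, mul_pow, norm_sq_eq ξ, ← tsum_mul_left]
      refine (Summable.tsum_le_tsum (weighted_sq_le hw k ξ)
        (Summable.of_nonneg_of_le (fun _ => sq_nonneg _)
          (weighted_sq_le hw k ξ) (summable_shift C k ξ)) (summable_shift C k ξ)).trans_eq ?_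
      exact (Equiv.subRight k).tsum_eq fun m => C ^ 2 * ‖ξ m‖ ^ 2

theorem weightedShift_apply (hw : ∀ n, ‖w n‖ ≤ C) (k : ℤ) (ξ : SeqSpace) (m : ℤ) :
    weightedShift w C hw k ξ m = w (m - k) * ξ (m - k) := rfl

/-- The two inner products are the same series up to a translation of the summation index by `k`. -/
theorem star_weightedShift {w' : ℤ → ℂ} {C' : ℝ} (hw : ∀ n, ‖w n‖ ≤ C) (hw' : ∀ n, ‖w' n‖ ≤ C')
    (k : ℤ) (h : ∀ n, w' (n + k) = star (w n)) :
    star (weightedShift w C hw k) = weightedShift w' C' hw' (-k) := by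
  rw [ContinuousLinearMap.star_eq_adjoint, eq_comm, ContinuousLinearMap.eq_adjoint_iff]
  intro ξ η
  rw [lp.inner_eq_tsum, lp.inner_eq_tsum]
  refine Eq.trans ?_ ((Equiv.addRight k).tsum_eq fun m => inner ℂ (ξ m) (weightedShift w C hw k η m))
  refine tsum_congr fun m => ?_
  rw [Equiv.coe_addRight, weightedShift_apply, weightedShift_apply, sub_neg_eq_add,
    add_sub_cancel_right, h, RCLike.inner_apply, RCLike.inner_apply, map_mul, ← starRingEnd_apply,
    Complex.conj_conj]
  ring

end SeqSpace

end WeightedShift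

/-! ### The representations on the orbits -/

namespace CStarSeminorm

variable {A : Type*} [NonUnitalRing A] [StarRing A] [Module ℂ A]

/-- The C⋆-seminorm `a ↦ ‖φ a‖` of a ⋆-homomorphism `φ` to a C⋆-algebra. -/
def ofHom {B : Type*} [NonUnitalCStarAlgebra B] (φ : A →⋆ₙₐ[ℂ] B) : CStarSeminorm A where
  toFun a := ‖φ a‖
  map_zero' := by rw [map_zero, norm_zero]
  add_le' a b := by rw [map_add]; exact norm_add_le _ _
  neg' a := by
    have h : φ a + φ (-a) = 0 := by rw [← map_add, add_neg_cancel, map_zero]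
    rw [← neg_eq_of_add_eq_zero_right h, norm_neg]
  smul' c a := by rw [map_smul, norm_smul]
  mul_le' a b := by rw [map_mul]; exact norm_mul_le _ _
  star_mul_self' a := by rw [map_mul, map_star, CStarRing.norm_star_mul_self, sq]

end CStarSeminorm

namespace PartialAut

noncomputable section

variable {X : Type*} [TopologicalSpace X] {θ : OpenPartialHomeomorph X X}

theorem norm_apply_le (f : C₀(X, ℂ)) (x : X) : ‖f x‖ ≤ ‖f‖ := f.toBCF.norm_coe_le_norm x

theorem norm_le_of_forall {f : C₀(X, ℂ)} {C : ℝ} (hC : 0 ≤ C) (h : ∀ x, ‖f x‖ ≤ C) : ‖f‖ ≤ C :=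
  (BoundedContinuousFunction.norm_le (f := f.toBCF) hC).2 h

open scoped Classical in
/-- The sequence `n ↦ f (θ ^ n x)`, with the value `0` where `θ ^ n x` is not defined. -/
def orbitValues (θ : OpenPartialHomeomorph X X) (x : X) (f : C₀(X, ℂ)) (n : ℤ) : ℂ :=
  if x ∈ (zpow θ n).source then f (zpow θ n x) else 0

theorem orbitValues_of_rel {x y : X} {n : ℤ} (h : Rel θ n x y) (f : C₀(X, ℂ)) :
    orbitValues θ x f n = f y := by
  rw [orbitValues, if_pos h.1, h.2]

theorem orbitValues_of_notMem {x : X} {n : ℤ} (h : x ∉ (zpow θ n).source) (f : C₀(X, ℂ)) :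
    orbitValues θ x f n = 0 :=
  if_neg h

theorem orbitValues_zero (x : X) (f : C₀(X, ℂ)) : orbitValues θ x f 0 = f x :=
  orbitValues_of_rel (rel_zero.2 rfl) f

theorem norm_orbitValues_le_norm (x : X) (f : C₀(X, ℂ)) (n : ℤ) :
    ‖orbitValues θ x f n‖ ≤ ‖f‖ := by
  by_cases hn : x ∈ (zpow θ n).source
  · rw [orbitValues_of_rel (Rel.mk hn)]
    exact norm_apply_le f _
  · rw [orbitValues_of_notMem hn, norm_zero]
    exact norm_nonneg f

variable [T2Space X]

/-- This is multiplicativity of the orbit representation on weights. If `θ ^ l` is undefined at `θ ^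
n x`, both sides vanish because `g` does at that point. -/
theorem orbitValues_mulN (x : X) {k l : ℤ} (f : N θ k) (g : N θ l) (n : ℤ) :
    orbitValues θ x (mulN f g).1 n = orbitValues θ x f.1 (l + n) * orbitValues θ x g.1 n := by
  by_cases hn : x ∈ (zpow θ n).source
  · have h := Rel.mk hn
    rw [orbitValues_of_rel h, orbitValues_of_rel h, mulN_apply]
    by_cases hl : zpow θ n x ∈ (zpow θ l).source
    · rw [orbitValues_of_rel (h.add (Rel.mk hl))]
    · rw [g.2 _ hl, mul_zero, mul_zero]
  · rw [orbitValues_of_notMem hn, orbitValues_of_notMem hn, mul_zero]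

theorem orbitValues_starN (x : X) {k : ℤ} (f : N θ k) (n : ℤ) :
    orbitValues θ x (starN f).1 (n + k) = star (orbitValues θ x f.1 n) := by
  by_cases hn : ∃ y z, Rel θ n x y ∧ Rel θ k y z
  · obtain ⟨y, z, hy, hz⟩ := hn
    have h := hy.add hz
    rw [add_comm] at h
    rw [orbitValues_of_rel h, orbitValues_of_rel hy, starN_apply_of_rel f hz]
  · have h1 : orbitValues θ x f.1 n = 0 := by
      by_cases hx : x ∈ (zpow θ n).source
      · rw [orbitValues_of_rel (Rel.mk hx)]
        exact f.2 _ fun hk => hn ⟨_, _, Rel.mk hx, Rel.mk hk⟩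
      · exact orbitValues_of_notMem hx _
    rw [h1, star_zero]
    by_cases hx : x ∈ (zpow θ (n + k)).source
    · have h := Rel.mk hx
      rw [orbitValues_of_rel h]
      refine starN_apply_of_not f fun y hy => hn ⟨y, _, ?_, hy⟩
      have := h.add (rel_neg.2 hy)
      rwa [show -k + (n + k) = n by ring] at this
    · exact orbitValues_of_notMem hx _

theorem orbitValues_add (x : X) (f g : C₀(X, ℂ)) (n : ℤ) :
    orbitValues θ x (f + g) n = orbitValues θ x f n + orbitValues θ x g n := by
  unfold orbitValues
  split_ifs
  · rfl
  · rw [add_zero]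

theorem orbitValues_smul (x : X) (c : ℂ) (f : C₀(X, ℂ)) (n : ℤ) :
    orbitValues θ x (c • f) n = c * orbitValues θ x f n := by
  unfold orbitValues
  split_ifs
  · rfl
  · rw [mul_zero]

/-- The operator of `s ^ k f` in the representation on the orbit of `x`. -/
def orbitOp (x : X) (k : ℤ) : N θ k →ₗ[ℂ] (SeqSpace →L[ℂ] SeqSpace) where
  toFun f := SeqSpace.weightedShift (orbitValues θ x f.1) ‖f.1‖ (norm_orbitValues_le_norm x f.1) k
  map_add' f g := by
    ext ξ m
    change orbitValues θ x (f.1 + g.1) (m - k) * _ = _ * ξ (m - k) + _ * ξ (m - k)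
    rw [orbitValues_add, add_mul]
  map_smul' c f := by
    ext ξ m
    change orbitValues θ x (c • f.1) (m - k) * _ = c * (_ * ξ (m - k))
    rw [orbitValues_smul, mul_assoc]

theorem orbitOp_apply (x : X) {k : ℤ} (f : N θ k) (ξ : SeqSpace) (m : ℤ) :
    orbitOp x k f ξ m = orbitValues θ x f.1 (m - k) * ξ (m - k) := rfl

theorem orbitOp_mulN (x : X) {k l : ℤ} (f : N θ k) (g : N θ l) :
    orbitOp x (k + l) (mulN f g) = orbitOp x k f * orbitOp x l g := by
  ext ξ m
  change orbitValues θ x (mulN f g).1 (m - (k + l)) * ξ (m - (k + l)) =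
    orbitValues θ x f.1 (m - k) * (orbitValues θ x g.1 (m - k - l) * ξ (m - k - l))
  rw [orbitValues_mulN, ← sub_sub, add_sub_cancel, mul_assoc]

theorem orbitOp_starN (x : X) {k : ℤ} (f : N θ k) :
    orbitOp x (-k) (starN f) = star (orbitOp x k f) :=
  (SeqSpace.star_weightedShift (norm_orbitValues_le_norm x f.1)
    (norm_orbitValues_le_norm x (starN f).1) k (orbitValues_starN x f)).symm

/-- The representation of the ⋆-algebra of `θ` on `ℓ²(ℤ)` given by the orbit of `x`. -/
def orbitRep (θ : OpenPartialHomeomorph X X) (x : X) : Alg θ →⋆ₙₐ[ℂ] (SeqSpace →L[ℂ] SeqSpace) :=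
  Alg.liftHom (orbitOp x) (fun _ _ => orbitOp_mulN x) (fun _ => orbitOp_starN x)

theorem orbitRep_sym (x : X) {k : ℤ} (f : N θ k) :
    orbitRep θ x (Alg.sym θ k f) = orbitOp x k f := Alg.liftHom_sym _ _ _ k f

/-- The C⋆-seminorm of the representation on the orbit of `x`. -/
def orbitNorm (θ : OpenPartialHomeomorph X X) (x : X) : CStarSeminorm (Alg θ) :=
  CStarSeminorm.ofHom (orbitRep θ x)

theorem orbitNorm_apply (x : X) (a : Alg θ) : orbitNorm θ x a = ‖orbitRep θ x a‖ := rfl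

/-- The matrix entries recover the coefficients: only the symbol of degree `m - n` moves the basis
vector at `n` to the one at `m`. -/
theorem orbitRep_single_apply (x : X) (a : Alg θ) (n m : ℤ) :
    orbitRep θ x a (lp.single 2 n 1) m = orbitValues θ x (Alg.coeff (m - n) a).1 n := by
  refine Alg.ind (P := fun a => orbitRep θ x a (lp.single 2 n 1) m =
    orbitValues θ x (Alg.coeff (m - n) a).1 n) ?_ (fun k f => ?_) (fun a b ha hb => ?_) a
  · rw [map_zero, map_zero]
    change (0 : ℂ) = orbitValues θ x (0 : C₀(X, ℂ)) n
    unfold orbitValues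
    split_ifs <;> rfl
  · rw [orbitRep_sym, orbitOp_apply]
    by_cases h : m - n = k
    · subst h
      rw [Alg.coeff_sym_self, sub_sub_cancel, lp.single_apply_self, mul_one]
    · rw [Alg.coeff_sym_of_ne (Ne.symm h), lp.single_apply_ne _ _ _ (by omega), mul_zero]
      change (0 : ℂ) = orbitValues θ x (0 : C₀(X, ℂ)) n
      unfold orbitValues
      split_ifs <;> rfl
  · rw [map_add, map_add]
    exact (congrArg₂ (· + ·) ha hb).trans (orbitValues_add x _ _ n).symm

/-- The value is the matrix entry at `(k, 0)`, and the basis vector at `0` is a unit vector. This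
supplies the coefficient hypothesis in the comparison of seminorms. -/
theorem norm_coeff_apply_le (x : X) (a : Alg θ) (k : ℤ) :
    ‖(Alg.coeff k a).1 x‖ ≤ orbitNorm θ x a := by
  have h := orbitRep_single_apply x a 0 k
  rw [sub_zero, orbitValues_zero] at h
  rw [← h, orbitNorm_apply]
  refine (lp.norm_apply_le_norm two_ne_zero _ _).trans ?_
  refine (ContinuousLinearMap.le_opNorm _ _).trans_eq ?_
  rw [lp.norm_single (by simp), norm_one, mul_one]

/-! ### The universal norm is given by the orbits -/

theorem star_sym_mul_sym {k : ℤ} (f : N θ k) :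
    star (Alg.sym θ k f) * Alg.sym θ k f = incl θ (star f.1 * f.1) := by
  rw [Alg.star_sym, Alg.sym_mul_sym]
  refine Alg.sym_congr (neg_add_cancel k) _ _ fun x => ?_
  rw [mulN_apply, ZeroAtInftyContinuousMap.mul_apply, ZeroAtInftyContinuousMap.star_apply]
  by_cases hx : x ∈ (zpow θ k).source
  · rw [starN_apply_of_rel f (Rel.mk hx)]
  · rw [f.2 x hx, mul_zero, mul_zero]

/-- By the C⋆-identity the square of the left side is the seminorm of $|f|^2$ in degree $0$, and on
the C⋆-algebra $C_0(X)$ every C⋆-seminorm is at most the norm. -/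
theorem apply_sym_le (p : CStarSeminorm (Alg θ)) {k : ℤ} (f : N θ k) :
    p (Alg.sym θ k f) ≤ ‖f.1‖ := by
  refine le_of_pow_le_pow_left₀ two_ne_zero (norm_nonneg _) ?_
  rw [← p.star_mul_self', star_sym_mul_sym, sq, ← CStarRing.norm_star_mul_self]
  exact p.apply_le_norm (incl θ) _

variable (θ) in
/-- The largest C⋆-seminorm on the ⋆-algebra of `θ`. -/
abbrev universalNorm : CStarSeminorm (Alg θ) := CStarSeminorm.universal (bddAbove (θ := θ))

theorem orbitNorm_le (x : X) (a : Alg θ) : orbitNorm θ x a ≤ universalNorm θ a :=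
  CStarSeminorm.le_universal bddAbove _ a

/-- The universal norm is the supremum of the norms in the representations on the orbits. -/
theorem universalNorm_le {a : Alg θ} {C : ℝ} (hC : 0 ≤ C) (h : ∀ x, orbitNorm θ x a ≤ C) :
    universalNorm θ a ≤ C := by
  have hb : ∀ a : Alg θ, BddAbove (Set.range fun x => orbitNorm θ x a) := fun a =>
    ⟨universalNorm θ a, by rintro _ ⟨x, rfl⟩; exact orbitNorm_le x a⟩
  have h0 : ∀ a : Alg θ, 0 ≤ ⨆ x, orbitNorm θ x a :=
    fun a => Real.iSup_nonneg fun x => (orbitNorm θ x).nonneg a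
  -- The seminorm compared is the universal one and the dominating function is the supremum over all
  -- orbits, which controls the supremum norm of each coefficient.
  refine (Alg.le_of_coeff (r := fun a => ⨆ x, orbitNorm θ x a) h0 (fun a => ?_)
    (fun b k => ?_) a).trans (Real.iSup_le h hC)
  · refine Real.iSup_le (fun x => ?_) (sq_nonneg _)
    rw [(orbitNorm θ x).star_mul_self']
    exact pow_le_pow_left₀ ((orbitNorm θ x).nonneg a) (le_ciSup (hb a) x) 2
  · exact (apply_sym_le _ _).trans (norm_le_of_forall (h0 b) fun x =>
      (norm_coeff_apply_le x b k).trans (le_ciSup (hb b) x))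

theorem exists_lt_orbitNorm {a : Alg θ} {c : ℝ} (hc : 0 ≤ c) (h : c < universalNorm θ a) :
    ∃ x, c < orbitNorm θ x a := by
  by_contra! hx
  exact absurd (universalNorm_le hc hx) (not_le.2 h)

/-! ### Semicontinuity of the norms along the orbits -/

theorem orbitRep_single (x : X) {k : ℤ} (f : N θ k) (n : ℤ) :
    orbitRep θ x (Alg.sym θ k f) (lp.single 2 n 1) =
      orbitValues θ x f.1 n • (lp.single 2 (n + k) 1 : SeqSpace) := by
  ext m
  rw [orbitRep_sym, orbitOp_apply, lp.coeFn_smul, Pi.smul_apply, smul_eq_mul]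
  by_cases h : m = n + k
  · subst h
    rw [add_sub_cancel_right, lp.single_apply_self, lp.single_apply_self]
  · rw [lp.single_apply_ne _ _ _ h, lp.single_apply_ne _ _ _ (by omega), mul_zero, mul_zero]

theorem continuousAt_orbitValues {x : X} {n : ℤ} (hx : x ∈ (zpow θ n).source) (f : C₀(X, ℂ)) :
    ContinuousAt (fun x => orbitValues θ x f n) x := by
  have h : ContinuousAt (fun x => f (zpow θ n x)) x :=
    (map_continuous f).continuousAt.comp ((zpow θ n).continuousAt hx)
  refine h.congr ?_
  filter_upwards [(zpow θ n).open_source.mem_nhds hx] with z hz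
  exact (orbitValues_of_rel (Rel.mk hz) f).symm

/-- The domain of `θ ^ n` is open, so the weights at `n` are given by a continuous formula near `x`.
On the boundary of the domain they may jump, which is why only lower semicontinuity of the norm
follows. -/
theorem continuousAt_orbitRep_single {x : X} {n : ℤ} (hx : x ∈ (zpow θ n).source) (a : Alg θ) :
    ContinuousAt (fun x => orbitRep θ x a (lp.single 2 n 1)) x := by
  refine Alg.ind (P := fun a => ContinuousAt (fun x => orbitRep θ x a (lp.single 2 n 1)) x)
    ?_ (fun k f => ?_) (fun a b ha hb => ?_) a
  · simp only [map_zero]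
    exact continuousAt_const
  · simp only [orbitRep_single]
    exact (continuousAt_orbitValues hx f.1).smul continuousAt_const
  · simp only [map_add]
    exact ha.add hb

theorem orbitRep_single_of_notMem {x : X} {n : ℤ} (hx : x ∉ (zpow θ n).source) (a : Alg θ) :
    orbitRep θ x a (lp.single 2 n 1) = 0 := by
  ext m
  rw [orbitRep_single_apply, orbitValues_of_notMem hx]
  rfl

theorem eventually_lt_orbitNorm {x : X} {a : Alg θ} {c : ℝ} (hc : 0 ≤ c)
    (h : c < orbitNorm θ x a) : ∀ᶠ z in nhds x, c < orbitNorm θ z a := by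
  classical
  obtain ⟨ξ, hξ⟩ : ∃ ξ, c * ‖ξ‖ < ‖orbitRep θ x a ξ‖ := by
    by_contra! hξ
    exact absurd (ContinuousLinearMap.opNorm_le_bound _ hc hξ) (not_le.2 h)
  -- Truncating the test vector to a large finite set keeps the strict inequality.
  have hsum := (lp.hasSum_single (p := 2) (by simp) ξ).mapL (orbitRep θ x a)
  obtain ⟨s, hs⟩ := (hsum.norm.eventually_const_lt hξ).exists
  have hsingle : ∀ n, (lp.single 2 n (ξ n) : SeqSpace) = ξ n • lp.single 2 n 1 := fun n => by
    rw [← lp.single_smul, smul_eq_mul, mul_one]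
  -- Indices at which the power of `θ` is undefined at `x` are discarded: the representation at `x`
  -- kills those basis vectors, and on the remaining ones it is continuous at `x`.
  set D : Finset ℤ := s.filter fun n => x ∈ (zpow θ n).source
  set ζ : SeqSpace := ∑ n ∈ D, lp.single 2 n (ξ n) with hζ
  have hζξ : ‖ζ‖ ≤ ‖ξ‖ := by
    have h1 := lp.norm_sum_single (E := fun _ : ℤ => ℂ) (p := 2) (by simp) (fun n => ξ n) D
    have h2 := lp.sum_rpow_le_norm_rpow (p := 2) (by simp) ξ D
    rw [← h1] at h2
    exact le_of_pow_le_pow_left₀ two_ne_zero (norm_nonneg _) (by simpa using h2)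
  have hx : c * ‖ξ‖ < ‖orbitRep θ x a ζ‖ := by
    refine hs.trans_eq (congrArg norm ?_)
    rw [hζ, map_sum]
    refine (Finset.sum_filter_of_ne fun n _ hn => ?_).symm
    by_contra hx
    refine hn ?_
    rw [hsingle, map_smul, orbitRep_single_of_notMem hx, smul_zero]
  have hcont : ContinuousAt (fun z => ‖orbitRep θ z a ζ‖) x := by
    refine ContinuousAt.norm ?_
    simp only [hζ, map_sum, hsingle, map_smul]
    exact tendsto_finsetSum _ fun n hn => Filter.Tendsto.const_smul
      (continuousAt_orbitRep_single (Finset.mem_filter.1 hn).2 a) _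
  filter_upwards [hcont.eventually_const_lt hx] with z hz
  by_contra! hle
  refine absurd hz (not_lt.2 ((ContinuousLinearMap.le_opNorm _ _).trans ?_))
  exact mul_le_mul hle hζξ (norm_nonneg _) hc

end

end PartialAut

namespace PartialAut

noncomputable section

variable {X Y : Type*} [TopologicalSpace X] [TopologicalSpace Y]
  {θ : OpenPartialHomeomorph X X} {π : X → Y} (hθ : ∀ x ∈ θ.source, π (θ x) = π x)

/-! ### Restriction to fibres and multiplication by functions on the base -/

theorem rel_of_fiber_rel_nat (y : Y) (n : ℕ) (x z : π ⁻¹' {y}) (h : Rel (fiber θ hθ y) n x z) :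
    Rel θ n x.1 z.1 := by
  induction n generalizing z with
  | zero => exact rel_zero.2 (congrArg Subtype.val (rel_zero.1 h))
  | succ n ih =>
    obtain ⟨w, hw, hs, rfl⟩ := rel_natSucc.1 h
    have hs' : w.1 ∈ θ.source := hs
    refine rel_natSucc.2 ⟨w.1, ih w hw, hs, ?_⟩
    exact (congrArg Subtype.val (dif_pos hs' : fiber θ hθ y w = _)).symm

/-- An orbit never leaves its fibre, so taking powers commutes with restriction, domains included.
-/
theorem fiber_rel_iff (y : Y) (k : ℤ) (x z : π ⁻¹' {y}) :
    Rel (fiber θ hθ y) k x z ↔ Rel θ k x.1 z.1 := by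
  have key : ∀ (n : ℕ) (x z : π ⁻¹' {y}), Rel (fiber θ hθ y) n x z ↔ Rel θ n x.1 z.1 :=
    fun n x z => ⟨rel_of_fiber_rel_nat hθ y n x z, fun h => (fiber_rel_nat hθ y n x z.1 h).2⟩
  obtain ⟨n, rfl | rfl⟩ := k.eq_nat_or_neg
  · exact key n x z
  · rw [rel_neg, rel_neg]
    exact key n z x

theorem Rel.invariant (hθ : ∀ x ∈ θ.source, π (θ x) = π x) {k : ℤ} {x z : X} (h : Rel θ k x z) : π z = π x := by
  obtain ⟨n, rfl | rfl⟩ := k.eq_nat_or_neg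
  · exact invariant_nat hθ n x z h
  · exact (invariant_nat hθ n z x (rel_neg.1 h)).symm

theorem exists_fiber_rel (y : Y) {k : ℤ} {x : π ⁻¹' {y}} {z : X} (h : Rel θ k x.1 z) :
    ∃ w : π ⁻¹' {y}, w.1 = z ∧ Rel (fiber θ hθ y) k x w :=
  ⟨⟨z, (h.invariant hθ).trans x.2⟩, rfl, (fiber_rel_iff hθ y k x _).2 h⟩

theorem mem_source_fiber_iff (y : Y) (k : ℤ) (x : π ⁻¹' {y}) :
    x ∈ (zpow (fiber θ hθ y) k).source ↔ x.1 ∈ (zpow θ k).source :=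
  ⟨fun h => ((fiber_rel_iff hθ y k x _).1 (Rel.mk h)).1, mem_source_fiber hθ y k x⟩

theorem orbitValues_restrict [T1Space Y] (hπ : Continuous π) (y : Y) (x : π ⁻¹' {y})
    (f : C₀(X, ℂ)) (n : ℤ) :
    orbitValues (fiber θ hθ y) x (restrict hπ y f) n = orbitValues θ x.1 f n := by
  by_cases hx : x ∈ (zpow (fiber θ hθ y) n).source
  · have h := Rel.mk hx
    rw [orbitValues_of_rel h, orbitValues_of_rel ((fiber_rel_iff hθ y n x _).1 h)]
    rfl
  · rw [orbitValues_of_notMem hx, orbitValues_of_notMem fun h => hx (mem_source_fiber hθ y n x h)]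

theorem orbitValues_baseMul (hθ : ∀ x ∈ θ.source, π (θ x) = π x) (hπ : Continuous π) (g : C₀(Y, ℂ)) (f : C₀(X, ℂ)) (x : X) (n : ℤ) :
    orbitValues θ x (baseMul hπ g f) n = g (π x) * orbitValues θ x f n := by
  by_cases hx : x ∈ (zpow θ n).source
  · have h := Rel.mk hx
    rw [orbitValues_of_rel h, orbitValues_of_rel h, ← h.invariant hθ]
    rfl
  · rw [orbitValues_of_notMem hx, orbitValues_of_notMem hx, mul_zero]

variable [T2Space X]

/-- The restriction of symbols to a fibre, as a linear map. -/
def restrictLin [T1Space Y] (hπ : Continuous π) (y : Y) (k : ℤ) :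
    N θ k →ₗ[ℂ] Alg (fiber θ hθ y) :=
  Alg.sym (fiber θ hθ y) k ∘ₗ
    { toFun := restrictN hθ hπ y
      map_add' := fun _ _ => rfl
      map_smul' := fun _ _ => rfl }

/-- The restriction of the elements of the ⋆-algebra of `θ` to a fibre of `π`. -/
def restrictHom [T1Space Y] (hπ : Continuous π) (y : Y) : Alg θ →⋆ₙₐ[ℂ] Alg (fiber θ hθ y) :=
  Alg.liftHom (restrictLin hθ hπ y)
    (fun k l f g => by
      refine Eq.trans ?_ (Alg.sym_mul_sym (restrictN hθ hπ y f) (restrictN hθ hπ y g)).symm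
      refine Alg.sym_congr rfl _ _ fun x => ?_
      rw [mulN_apply]
      refine (mulN_apply f g x.1).trans ?_
      by_cases hx : x.1 ∈ (zpow θ l).source
      · obtain ⟨w, hw, hr⟩ := exists_fiber_rel hθ y (Rel.mk hx)
        rw [← hw, hr.2]
        rfl
      · rw [g.2 _ hx, mul_zero, (restrictN hθ hπ y g).2 x
          fun h => hx ((mem_source_fiber_iff hθ y l x).1 h), mul_zero])
    (fun k f => by
      refine Eq.trans ?_ (Alg.star_sym (restrictN hθ hπ y f)).symm
      refine Alg.sym_congr rfl _ _ fun x => ?_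
      change (starN f).1 x.1 = _
      by_cases h : ∃ z, Rel θ (-k) x.1 z
      · obtain ⟨z, hz⟩ := h
        obtain ⟨w, rfl, hw⟩ := exists_fiber_rel hθ y hz
        rw [starN_apply_of_rel f (rel_neg.1 hz), starN_apply_of_rel _ (rel_neg.1 hw)]
        rfl
      · rw [starN_apply_of_not f fun z hz => h ⟨z, rel_neg.2 hz⟩, starN_apply_of_not _ fun w hw =>
          h ⟨w.1, rel_neg.2 ((fiber_rel_iff hθ y k w x).1 hw)⟩])

theorem restrictHom_sym [T1Space Y] (hπ : Continuous π) (y : Y) (k : ℤ) (f : N θ k) :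
    restrictHom hθ hπ y (Alg.sym θ k f) = Alg.sym (fiber θ hθ y) k (restrictN hθ hπ y f) :=
  Alg.liftHom_sym _ _ _ k f

/-- The orbit of `x` is the same in the fibre and in the whole space. This identifies the norm over
a fibre with a supremum of orbit norms of the total space. -/
theorem orbitRep_restrictHom [T1Space Y] (hπ : Continuous π) (y : Y) (x : π ⁻¹' {y}) (a : Alg θ) :
    orbitRep (fiber θ hθ y) x (restrictHom hθ hπ y a) = orbitRep θ x.1 a := by
  refine Alg.ind (P := fun a => orbitRep (fiber θ hθ y) x (restrictHom hθ hπ y a) =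
    orbitRep θ x.1 a) (by simp only [map_zero]) (fun k f => ?_)
    (fun a b ha hb => by simp only [map_add, ha, hb]) a
  rw [restrictHom_sym, orbitRep_sym, orbitRep_sym]
  ext ξ m
  rw [orbitOp_apply, orbitOp_apply]
  exact congrArg (· * _) (orbitValues_restrict hθ hπ y x f.1 (m - k))

/-- Multiplication by `g ∘ π` on the ⋆-algebra of `θ`. -/
def baseMulAlg (θ : OpenPartialHomeomorph X X) (hπ : Continuous π) (g : C₀(Y, ℂ)) :
    Alg θ →ₗ[ℂ] Alg θ :=
  Alg.lift fun k => Alg.sym θ k ∘ₗ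
    { toFun := baseMulN hπ g
      map_add' := fun f f' => Subtype.ext <| ZeroAtInftyContinuousMap.ext fun x =>
        mul_add (g (π x)) (f.1 x) (f'.1 x)
      map_smul' := fun c f => Subtype.ext <| ZeroAtInftyContinuousMap.ext fun x =>
        mul_left_comm (g (π x)) c (f.1 x) }

theorem baseMulAlg_sym (hπ : Continuous π) (g : C₀(Y, ℂ)) (k : ℤ) (f : N θ k) :
    baseMulAlg θ hπ g (Alg.sym θ k f) = Alg.sym θ k (baseMulN hπ g f) :=
  Alg.lift_sym _ k f

/-- Since `π` is invariant, `g ∘ π` is constant along the orbit and acts by a scalar. The algebraic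
identities for the action of $C_0(Y)$ are checked through this formula. -/
theorem orbitRep_baseMulAlg (hθ : ∀ x ∈ θ.source, π (θ x) = π x) (hπ : Continuous π) (g : C₀(Y, ℂ)) (x : X) (a : Alg θ) :
    orbitRep θ x (baseMulAlg θ hπ g a) = g (π x) • orbitRep θ x a := by
  refine Alg.ind (P := fun a => orbitRep θ x (baseMulAlg θ hπ g a) = g (π x) • orbitRep θ x a)
    (by simp only [map_zero, smul_zero]) (fun k f => ?_)
    (fun a b ha hb => by simp only [map_add, smul_add, ha, hb]) a
  rw [baseMulAlg_sym, orbitRep_sym, orbitRep_sym]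
  ext ξ m
  rw [orbitOp_apply]
  refine (congrArg (· * _) (orbitValues_baseMul hθ hπ g f.1 x (m - k))).trans ?_
  exact mul_assoc _ _ _

/-! ### Continuity of the norm along the fibres -/

variable [T2Space Y]

/-- The universal norm of the restriction to the fibre over `y`. -/
def fiberNorm (hπ : Continuous π) (y : Y) : CStarSeminorm (Alg θ) :=
  CStarSeminorm.ofHom ((CrossedProduct.of (fiber θ hθ y)).comp (restrictHom hθ hπ y))

theorem fiberNorm_apply (hπ : Continuous π) (y : Y) (a : Alg θ) :
    fiberNorm hθ hπ y a = universalNorm (fiber θ hθ y) (restrictHom hθ hπ y a) :=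
  CStarSeminorm.Completion.norm_of _

theorem orbitNorm_le_fiberNorm (hπ : Continuous π) (x : X) (a : Alg θ) :
    orbitNorm θ x a ≤ fiberNorm hθ hπ (π x) a := by
  rw [fiberNorm_apply, orbitNorm_apply,
    ← orbitRep_restrictHom hθ hπ (π x) ⟨x, rfl⟩]
  exact orbitNorm_le _ _

theorem exists_lt_orbitNorm_of_lt_fiberNorm (hπ : Continuous π) {y : Y} {a : Alg θ} {c : ℝ}
    (hc : 0 ≤ c) (h : c < fiberNorm hθ hπ y a) : ∃ x, π x = y ∧ c < orbitNorm θ x a := by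
  rw [fiberNorm_apply] at h
  obtain ⟨x, hx⟩ := exists_lt_orbitNorm hc h
  refine ⟨x.1, x.2, ?_⟩
  rwa [orbitNorm_apply, orbitRep_restrictHom hθ hπ y x] at hx

theorem fiberNorm_le (hπ : Continuous π) (y : Y) (a : Alg θ) :
    fiberNorm hθ hπ y a ≤ universalNorm θ a := CStarSeminorm.le_universal bddAbove _ a

theorem fiberNorm_sym_le (hπ : Continuous π) {y : Y} {k : ℤ} {f : N θ k} {C : ℝ} (hC : 0 ≤ C)
    (h : ∀ x, π x = y → ‖f.1 x‖ ≤ C) : fiberNorm hθ hπ y (Alg.sym θ k f) ≤ C := by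
  rw [fiberNorm_apply, restrictHom_sym]
  exact (apply_sym_le _ _).trans (norm_le_of_forall hC fun x => h x.1 x.2)

theorem norm_coeff_le_fiberNorm (hπ : Continuous π) (x : X) (k : ℤ) (a : Alg θ) :
    ‖(Alg.coeff k a).1 x‖ ≤ fiberNorm hθ hπ (π x) a :=
  (norm_coeff_apply_le x a k).trans (orbitNorm_le_fiberNorm hθ hπ x a)

theorem isCompact_le_norm (f : C₀(X, ℂ)) {ε : ℝ} (hε : 0 < ε) : IsCompact {x | ε ≤ ‖f x‖} := by
  have h1 : ∀ᶠ x in Filter.cocompact X, ‖f x‖ < ε := by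
    have := (zero_at_infty f).norm
    rw [norm_zero] at this
    exact this.eventually_lt_const hε
  obtain ⟨K, hK, hK'⟩ := Filter.mem_cocompact.1 h1
  refine hK.of_isClosed_subset (isClosed_le continuous_const (map_continuous f).norm) fun x hx => ?_
  by_contra hxK
  have h2 : ‖f x‖ < ε := hK' hxK
  exact not_lt.2 hx h2

/-- The set where `f` is at least `C + ε` in absolute value is compact, so its image in `Y` is
closed; this image misses `y`, hence a neighbourhood of `y`. -/
theorem eventually_fiberNorm_sym_le (hπ : Continuous π) {y : Y} {k : ℤ} {f : N θ k} {C ε : ℝ}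
    (hC : 0 ≤ C) (hε : 0 < ε) (h : ∀ x, π x = y → ‖f.1 x‖ ≤ C) :
    ∀ᶠ z in nhds y, fiberNorm hθ hπ z (Alg.sym θ k f) ≤ C + ε := by
  have hK := (isCompact_le_norm f.1 (add_pos_of_nonneg_of_pos hC hε)).image hπ
  have hy : y ∉ π '' {x | C + ε ≤ ‖f.1 x‖} := by
    rintro ⟨x, hx, hxy⟩
    have := h x hxy
    have hx' : C + ε ≤ ‖f.1 x‖ := hx
    linarith
  filter_upwards [hK.isClosed.isOpen_compl.mem_nhds hy] with z hz
  refine fiberNorm_sym_le hθ hπ (by positivity) fun x hx => ?_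
  by_contra! hlt
  exact hz ⟨x, hlt.le, hx⟩

theorem continuous_fiberNorm (hπ : Continuous π) (hopen : IsOpenMap π) (a : Alg θ) :
    Continuous fun y => fiberNorm hθ hπ y a := by
  rw [continuous_iff_continuousAt]
  refine fun y => tendsto_order.2 ⟨fun c hc => ?_, fun c hc => ?_⟩
  · rcases lt_or_ge c 0 with h0 | h0
    · exact Filter.Eventually.of_forall fun z => h0.trans_le (CStarSeminorm.nonneg _ a)
    -- Lower semicontinuity: an orbit over `y` with large norm has neighbours with large norm, and
    -- the open map `π` sends these onto a neighbourhood of `y`.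
    · obtain ⟨x, rfl, hx⟩ := exists_lt_orbitNorm_of_lt_fiberNorm hθ hπ h0 hc
      filter_upwards [hopen.image_mem_nhds (eventually_lt_orbitNorm h0 hx)]
      rintro _ ⟨z, hz, rfl⟩
      exact lt_of_lt_of_le hz (orbitNorm_le_fiberNorm hθ hπ z a)
  -- Upper semicontinuity: the root argument compares the norms over nearby fibres with the norm
  -- over `y` and leaves only single coefficients to control.
  · obtain ⟨d, hd, hdc⟩ := exists_between hc
    refine (Alg.eventually_le_of_coeff (F := nhds y) (p := fiberNorm hθ hπ)
      (r := fiberNorm hθ hπ y) (CStarSeminorm.nonneg _)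
      (fun a => (CStarSeminorm.star_mul_self' _ a).le) (fun b k ε hε => ?_) a hd).mono
      fun z hz => hz.trans_lt hdc
    refine eventually_fiberNorm_sym_le hθ hπ (CStarSeminorm.nonneg _ b) hε ?_
    rintro x rfl
    exact norm_coeff_le_fiberNorm hθ hπ x k b

end

end PartialAut

/-! ### Cutoff functions and approximation in `C₀(X)` -/

noncomputable section Approximation

theorem ZeroAtInftyContinuousMap.exists_cutoff {X : Type*} [TopologicalSpace X] [T2Space X]
    [LocallyCompactSpace X] {K t : Set X} (hK : IsCompact K) (ht : IsClosed t) (h : Disjoint K t) :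
    ∃ χ : C₀(X, ℂ), (∀ x ∈ K, χ x = 1) ∧ (∀ x ∈ t, χ x = 0) ∧ HasCompactSupport χ ∧
      (∀ x, ‖χ x‖ ≤ 1) ∧ ∀ x, ‖1 - χ x‖ ≤ 1 := by
  obtain ⟨φ, h1, h0, hc, hI⟩ := exists_continuous_one_zero_of_isCompact hK ht h
  have hc' : HasCompactSupport fun x => (φ x : ℂ) :=
    hc.comp_left (g := fun r : ℝ => (r : ℂ)) Complex.ofReal_zero
  refine ⟨⟨⟨fun x => (φ x : ℂ), Complex.continuous_ofReal.comp (map_continuous φ)⟩,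
    hc'.is_zero_at_infty⟩, fun x hx => ?_, fun x hx => ?_, hc', fun x => ?_, fun x => ?_⟩
  · exact (congrArg Complex.ofReal (h1 hx)).trans Complex.ofReal_one
  · exact (congrArg Complex.ofReal (h0 hx)).trans Complex.ofReal_zero
  · change ‖(φ x : ℂ)‖ ≤ 1
    rw [Complex.norm_of_nonneg (hI x).1]
    exact (hI x).2
  · change ‖1 - (φ x : ℂ)‖ ≤ 1
    rw [← Complex.ofReal_one, ← Complex.ofReal_sub, Complex.norm_of_nonneg (sub_nonneg.2 (hI x).2)]
    linarith [(hI x).1]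

namespace PartialAut

variable {X Y : Type*} [TopologicalSpace X] [TopologicalSpace Y] [T2Space X] [T2Space Y]
  {θ : OpenPartialHomeomorph X X} {π : X → Y}

/-- A function in `C₀(X)` that vanishes over a closed set `Z` is approximated by its products with
functions in `C₀(Y)` that vanish on `Z`. -/
theorem exists_norm_sub_baseMul_le [LocallyCompactSpace Y] (hπ : Continuous π) (f : C₀(X, ℂ))
    {Z : Set Y} (hZ : IsClosed Z) (hf : ∀ x, π x ∈ Z → f x = 0) {ε : ℝ} (hε : 0 < ε) :
    ∃ g : C₀(Y, ℂ), (∀ y ∈ Z, g y = 0) ∧ ‖f - baseMul hπ g f‖ ≤ ε := by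
  have hd : Disjoint (π '' {x | ε ≤ ‖f x‖}) Z := by
    rw [Set.disjoint_left]
    rintro _ ⟨x, hx, rfl⟩ hxZ
    have hx' : ε ≤ ‖f x‖ := hx
    rw [hf x hxZ, norm_zero] at hx'
    exact absurd hx' (not_le.2 hε)
  -- The cutoff is `1` on the image of the compact set where `f` is not small; elsewhere the error
  -- is at most the size of `f`.
  obtain ⟨g, hg1, hg0, -, -, hg⟩ := ZeroAtInftyContinuousMap.exists_cutoff
    ((isCompact_le_norm f hε).image hπ) hZ hd
  refine ⟨g, hg0, norm_le_of_forall hε.le fun x => ?_⟩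
  change ‖f x - g (π x) * f x‖ ≤ ε
  by_cases hx : ε ≤ ‖f x‖
  · rw [hg1 _ ⟨x, hx, rfl⟩, one_mul, sub_self, norm_zero]
    exact hε.le
  · rw [← one_sub_mul, norm_mul]
    exact (mul_le_of_le_one_left (norm_nonneg _) (hg _)).trans (not_le.1 hx).le

/-- The restrictions to a fibre of the functions in `C₀(X)` that vanish outside an open set `U` are
dense in the functions that vanish outside the trace of `U`. -/
theorem exists_norm_restrict_sub_le [LocallyCompactSpace X] [NormalSpace X] (hπ : Continuous π)
    (y : Y) {U : Set X} (hU : IsOpen U) (f : C₀(π ⁻¹' {y}, ℂ)) (hf : ∀ x, x.1 ∉ U → f x = 0)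
    {ε : ℝ} (hε : 0 < ε) :
    ∃ F : C₀(X, ℂ), (∀ x ∉ U, F x = 0) ∧ ‖restrict hπ y F - f‖ ≤ ε := by
  -- The Tietze extension need not vanish at infinity or outside `U`; the compactly supported cutoff
  -- below forces both, at a cost of at most `ε` on the fibre.
  obtain ⟨F, hF⟩ := ContinuousMap.exists_extension
    (isClosed_singleton.preimage hπ).isClosedEmbedding_subtypeVal f.toContinuousMap
  have hF' : ∀ x : π ⁻¹' {y}, F x.1 = f x := fun x => congrArg (fun φ => φ x) hF
  have hd : Disjoint (Subtype.val '' {x | ε ≤ ‖f x‖}) Uᶜ := by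
    rw [Set.disjoint_left]
    rintro _ ⟨x, hx, rfl⟩ hxU
    have hx' : ε ≤ ‖f x‖ := hx
    rw [hf x hxU, norm_zero] at hx'
    exact absurd hx' (not_le.2 hε)
  obtain ⟨χ, hχ1, hχ0, hc, -, hχ⟩ := ZeroAtInftyContinuousMap.exists_cutoff
    ((isCompact_le_norm f hε).image continuous_subtype_val) hU.isClosed_compl hd
  refine ⟨⟨⟨fun x => χ x * F x, (map_continuous χ).mul (map_continuous F)⟩,
    (hc.mul_right (f' := F)).is_zero_at_infty⟩, fun x hx => ?_, norm_le_of_forall hε.le fun x => ?_⟩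
  · exact (congrArg (· * F x) (hχ0 x hx)).trans (zero_mul _)
  · change ‖χ x.1 * F x.1 - f x‖ ≤ ε
    rw [hF']
    by_cases hx : ε ≤ ‖f x‖
    · rw [hχ1 _ ⟨x, hx, rfl⟩, one_mul, sub_self, norm_zero]
      exact hε.le
    · rw [← sub_one_mul, norm_mul, norm_sub_rev]
      exact (mul_le_of_le_one_left (norm_nonneg _) (hχ _)).trans (not_le.1 hx).le

end PartialAut

end Approximation

/-! ### Maps between crossed products -/

namespace CrossedProduct

open PartialAut

noncomputable section

variable {X : Type*} [TopologicalSpace X] [T2Space X] {θ : OpenPartialHomeomorph X X}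

theorem norm_of (a : Alg θ) : ‖of θ a‖ = universalNorm θ a := CStarSeminorm.Completion.norm_of a

theorem denseRange_of : DenseRange (of θ) := CStarSeminorm.Completion.denseRange_of

theorem norm_sym_le {k : ℤ} (f : N θ k) : ‖sym θ k f‖ ≤ ‖f.1‖ :=
  (norm_of _).trans_le (apply_sym_le _ f)

theorem sym_sub {k : ℤ} (f g : N θ k) : sym θ k f - sym θ k g = sym θ k (f - g) := by
  unfold sym
  rw [← map_sub, ← map_sub]

/-- The canonical map to the crossed product, as a linear map. -/
def ofLin (θ : OpenPartialHomeomorph X X) : Alg θ →ₗ[ℂ] CrossedProduct θ where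
  toFun := of θ
  map_add' := map_add (of θ)
  map_smul' := map_smul (of θ)

/-- An element of the ⋆-algebra is determined in the crossed product by its images in the
representations on the orbits. -/
theorem of_eq_of_orbitRep {a b : Alg θ} (h : ∀ x, orbitRep θ x a = orbitRep θ x b) :
    of θ a = of θ b := by
  rw [← sub_eq_zero, ← map_sub, ← norm_le_zero_iff, norm_of]
  refine universalNorm_le le_rfl fun x => ?_
  rw [orbitNorm_apply, map_sub, h, sub_self, norm_zero]

theorem clm_ext {B : Type*} [NormedAddCommGroup B] [NormedSpace ℂ B]
    {S T : CrossedProduct θ →L[ℂ] B} (h : ∀ a, S (of θ a) = T (of θ a)) : S = T :=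
  ContinuousLinearMap.ext fun a => denseRange_of.induction_on (p := fun a => S a = T a) a
    (isClosed_eq S.continuous T.continuous) h

/-- The extension to the crossed product of a linear map on the ⋆-algebra that is bounded for the
universal norm. -/
def extend {B : Type*} [NormedAddCommGroup B] [NormedSpace ℂ B] [CompleteSpace B]
    (T : Alg θ →ₗ[ℂ] B) : CrossedProduct θ →L[ℂ] B :=
  T.extendOfNorm (ofLin θ)

theorem extend_of {B : Type*} [NormedAddCommGroup B] [NormedSpace ℂ B] [CompleteSpace B]
    {T : Alg θ →ₗ[ℂ] B} {C : ℝ} (h : ∀ a, ‖T a‖ ≤ C * universalNorm θ a) (a : Alg θ) :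
    extend T (of θ a) = T a :=
  LinearMap.extendOfNorm_eq (e := ofLin θ) denseRange_of
    ⟨C, fun a => (h a).trans_eq (congrArg (C * ·) (norm_of a).symm)⟩ a

theorem norm_extend_le {B : Type*} [NormedAddCommGroup B] [NormedSpace ℂ B] [CompleteSpace B]
    {T : Alg θ →ₗ[ℂ] B} {C : ℝ} (h : ∀ a, ‖T a‖ ≤ C * universalNorm θ a) (a : CrossedProduct θ) :
    ‖extend T a‖ ≤ C * ‖a‖ :=
  LinearMap.norm_extendOfNorm_apply_le (e := ofLin θ) denseRange_of C
    (fun a => (h a).trans_eq (congrArg (C * ·) (norm_of a).symm)) a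

/-! ### The action of $C_0(Y)$ by multipliers -/

variable {Y : Type*} [TopologicalSpace Y] {π : X → Y} (hθ : ∀ x ∈ θ.source, π (θ x) = π x)

/-- Multiplication by `g ∘ π` on the crossed product. -/
def baseOp (θ : OpenPartialHomeomorph X X) (hπ : Continuous π) (g : C₀(Y, ℂ)) :
    CrossedProduct θ →L[ℂ] CrossedProduct θ :=
  extend (ofLin θ ∘ₗ baseMulAlg θ hπ g)

/-- Weighing each orbit by its own value of `g`, instead of by the norm of `g`, is what localises
the norm near a point of the base in `norm_loc_of_le`. -/
theorem universalNorm_baseMulAlg_le (hθ : ∀ x ∈ θ.source, π (θ x) = π x) (hπ : Continuous π)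
    (g : C₀(Y, ℂ)) {a : Alg θ} {C : ℝ} (hC : 0 ≤ C)
    (h : ∀ x, ‖g (π x)‖ * orbitNorm θ x a ≤ C) : universalNorm θ (baseMulAlg θ hπ g a) ≤ C := by
  refine universalNorm_le hC fun x => ?_
  rw [orbitNorm_apply, orbitRep_baseMulAlg hθ, norm_smul]
  exact h x

theorem baseOp_of (hθ : ∀ x ∈ θ.source, π (θ x) = π x) (hπ : Continuous π) (g : C₀(Y, ℂ))
    (a : Alg θ) : baseOp θ hπ g (of θ a) = of θ (baseMulAlg θ hπ g a) := by
  refine extend_of (C := ‖g‖) (fun a => ?_) a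
  refine (norm_of _).trans_le (universalNorm_baseMulAlg_le hθ hπ g
    (mul_nonneg (norm_nonneg _) (CStarSeminorm.nonneg _ a)) fun x => ?_)
  exact mul_le_mul (norm_apply_le g (π x)) (orbitNorm_le x a) (CStarSeminorm.nonneg _ a)
    (norm_nonneg g)

theorem baseOp_sym (hθ : ∀ x ∈ θ.source, π (θ x) = π x) (hπ : Continuous π) (g : C₀(Y, ℂ)) (k : ℤ)
    (f : N θ k) : baseOp θ hπ g (sym θ k f) = sym θ k (baseMulN hπ g f) := by
  unfold sym
  rw [baseOp_of hθ, baseMulAlg_sym]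

theorem baseOp_mul (hθ : ∀ x ∈ θ.source, π (θ x) = π x) (hπ : Continuous π) (g : C₀(Y, ℂ))
    (a b : CrossedProduct θ) : baseOp θ hπ g (a * b) = baseOp θ hπ g a * b := by
  refine CStarSeminorm.Completion.ind₂ (P := fun a b => baseOp θ hπ g (a * b) = baseOp θ hπ g a * b)
    (isClosed_eq (by fun_prop) (by fun_prop)) (fun a b => ?_) a b
  change baseOp θ hπ g (of θ a * of θ b) = baseOp θ hπ g (of θ a) * of θ b
  rw [← map_mul, baseOp_of hθ, baseOp_of hθ, ← map_mul]
  refine of_eq_of_orbitRep fun x => ?_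
  rw [orbitRep_baseMulAlg hθ, map_mul, map_mul, orbitRep_baseMulAlg hθ, smul_mul_assoc]

theorem mul_baseOp (hθ : ∀ x ∈ θ.source, π (θ x) = π x) (hπ : Continuous π) (g : C₀(Y, ℂ))
    (a b : CrossedProduct θ) : a * baseOp θ hπ g b = baseOp θ hπ g (a * b) := by
  refine CStarSeminorm.Completion.ind₂ (P := fun a b => a * baseOp θ hπ g b = baseOp θ hπ g (a * b))
    (isClosed_eq (by fun_prop) (by fun_prop)) (fun a b => ?_) a b
  change of θ a * baseOp θ hπ g (of θ b) = baseOp θ hπ g (of θ a * of θ b)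
  rw [← map_mul, baseOp_of hθ, baseOp_of hθ, ← map_mul]
  refine of_eq_of_orbitRep fun x => ?_
  rw [map_mul, orbitRep_baseMulAlg hθ, orbitRep_baseMulAlg hθ, map_mul, mul_smul_comm]

theorem star_baseOp (hθ : ∀ x ∈ θ.source, π (θ x) = π x) (hπ : Continuous π) (g : C₀(Y, ℂ))
    (a : CrossedProduct θ) : star (baseOp θ hπ g a) = baseOp θ hπ (star g) (star a) := by
  refine CStarSeminorm.Completion.ind (P := fun a => star (baseOp θ hπ g a) =
    baseOp θ hπ (star g) (star a)) (isClosed_eq (by fun_prop) (by fun_prop)) (fun a => ?_) a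
  change star (baseOp θ hπ g (of θ a)) = baseOp θ hπ (star g) (star (of θ a))
  rw [← map_star (of θ), baseOp_of hθ, baseOp_of hθ, ← map_star (of θ)]
  refine of_eq_of_orbitRep fun x => ?_
  rw [map_star (orbitRep θ x), orbitRep_baseMulAlg hθ, orbitRep_baseMulAlg hθ,
    map_star (orbitRep θ x), star_smul]
  rfl

/-- The action of `C₀(Y)` on the crossed product by multipliers. -/
def baseHom (hπ : Continuous π) : C₀(Y, ℂ) →⋆ₙₐ[ℂ] 𝓜(ℂ, CrossedProduct θ) where
  toFun g :=
    { fst := baseOp θ hπ g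
      snd := baseOp θ hπ g
      central := fun a b => by rw [← baseOp_mul hθ, mul_baseOp hθ] }
  map_smul' c g := by
    have h : baseOp θ hπ (c • g) = c • baseOp θ hπ g := clm_ext fun a => by
      rw [smul_apply, baseOp_of hθ, baseOp_of hθ, ← map_smul]
      refine of_eq_of_orbitRep fun x => ?_
      rw [map_smul, orbitRep_baseMulAlg hθ, orbitRep_baseMulAlg hθ, smul_smul]
      rfl
    exact DoubleCentralizer.ext _ _ _ _ (Prod.ext h h)
  map_zero' := by
    have h : baseOp θ hπ (0 : C₀(Y, ℂ)) = 0 := clm_ext fun a => by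
      rw [zero_apply, baseOp_of hθ, ← map_zero (of θ)]
      refine of_eq_of_orbitRep fun x => ?_
      rw [orbitRep_baseMulAlg hθ, map_zero]
      exact zero_smul _ _
    exact DoubleCentralizer.ext _ _ _ _ (Prod.ext h h)
  map_add' g g' := by
    have h : baseOp θ hπ (g + g') = baseOp θ hπ g + baseOp θ hπ g' := clm_ext fun a => by
      rw [add_apply, baseOp_of hθ, baseOp_of hθ, baseOp_of hθ, ← map_add]
      refine of_eq_of_orbitRep fun x => ?_
      rw [map_add, orbitRep_baseMulAlg hθ, orbitRep_baseMulAlg hθ, orbitRep_baseMulAlg hθ,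
        ← add_smul]
      rfl
    exact DoubleCentralizer.ext _ _ _ _ (Prod.ext h h)
  map_mul' g g' := by
    have h : ∀ g g' : C₀(Y, ℂ), baseOp θ hπ (g * g') = baseOp θ hπ g * baseOp θ hπ g' :=
      fun g g' => clm_ext fun a => by
        rw [mul_apply_eq_comp, baseOp_of hθ, baseOp_of hθ, baseOp_of hθ]
        refine of_eq_of_orbitRep fun x => ?_
        rw [orbitRep_baseMulAlg hθ, orbitRep_baseMulAlg hθ, orbitRep_baseMulAlg hθ, smul_smul]
        rfl
    -- Right multipliers compose in the opposite order; commutativity of $C_0(Y)$ compensates.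
    exact DoubleCentralizer.ext _ _ _ _
      (Prod.ext (h g g') ((congrArg (baseOp θ hπ) (mul_comm g g')).trans (h g' g)))
  map_star' g := by
    have h : ∀ a, baseOp θ hπ (star g) a = star (baseOp θ hπ g (star a)) := fun a => by
      rw [star_baseOp hθ, star_star]
    exact DoubleCentralizer.ext _ _ _ _
      (Prod.ext (ContinuousLinearMap.ext h) (ContinuousLinearMap.ext h))

end

end CrossedProduct

/-! ### The crossed product as a continuous field -/

namespace C0Algebra

theorem norm_loc_le {Y : Type*} [TopologicalSpace Y] {A : Type*} [NonUnitalCStarAlgebra A]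
    (S : C0Algebra Y A) (y : Y) (a : A) : ‖S.loc y a‖ ≤ ‖a‖ := by
  rw [Fiber.norm_loc, ← dist_zero_right]
  exact Metric.infDist_le_dist_of_mem (zero_mem _)

theorem continuous_loc {Y : Type*} [TopologicalSpace Y] {A : Type*} [NonUnitalCStarAlgebra A]
    (S : C0Algebra Y A) (y : Y) : Continuous (S.loc y) := by
  refine (LipschitzWith.of_dist_le_mul (K := 1) fun a b => ?_).continuous
  rw [NNReal.coe_one, one_mul, dist_eq_norm, dist_eq_norm]
  exact S.norm_loc_le y (a - b)

end C0Algebra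

namespace CrossedProduct

open PartialAut

noncomputable section

variable {X : Type*} [TopologicalSpace X] [T2Space X] {θ : OpenPartialHomeomorph X X}
  {Y : Type*} [TopologicalSpace Y] [T2Space Y] {π : X → Y}
  (hθ : ∀ x ∈ θ.source, π (θ x) = π x) (hπ : Continuous π)

theorem exists_norm_sym_sub_baseOp_le [LocallyCompactSpace Y]
    (hθ : ∀ x ∈ θ.source, π (θ x) = π x) {k : ℤ} (f : N θ k) {Z : Set Y} (hZ : IsClosed Z)
    (hf : ∀ x, π x ∈ Z → f.1 x = 0) {ε : ℝ} (hε : 0 < ε) :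
    ∃ g : C₀(Y, ℂ), (∀ y ∈ Z, g y = 0) ∧ ‖sym θ k f - baseOp θ hπ g (sym θ k f)‖ ≤ ε := by
  obtain ⟨g, hg, h⟩ := exists_norm_sub_baseMul_le hπ f.1 hZ hf hε
  refine ⟨g, hg, ?_⟩
  rw [baseOp_sym hθ, sym_sub]
  exact (norm_sym_le _).trans h

theorem of_mem_of_sym_mem {p : Submodule ℂ (CrossedProduct θ)} {a : Alg θ}
    (h : ∀ k, sym θ k (Alg.coeff k a) ∈ p) : of θ a ∈ p := by
  obtain ⟨M, hM⟩ := Alg.exists_mem_degreeLE a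
  rw [Alg.eq_sum_of_mem_degreeLE hM, map_sum]
  exact sum_mem fun k _ => h k

theorem eq_top_of_sym_mem {p : Submodule ℂ (CrossedProduct θ)}
    (hp : IsClosed (p : Set (CrossedProduct θ))) (h : ∀ k f, sym θ k f ∈ p) : p = ⊤ :=
  eq_top_iff.2 fun a _ => denseRange_of.induction_on (p := fun a => a ∈ p) a hp
    fun _ => of_mem_of_sym_mem fun k => h k _

theorem norm_apply_le_norm_sym {k : ℤ} (f : N θ k) (x : X) : ‖f.1 x‖ ≤ ‖sym θ k f‖ := by
  have h := norm_coeff_apply_le x (Alg.sym θ k f) k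
  rw [Alg.coeff_sym_self] at h
  exact (h.trans (orbitNorm_le x _)).trans_eq (norm_of _).symm

/-- The crossed product by a partial automorphism `θ` with `π ∘ θ = π`, as a `C₀(Y)`-algebra. -/
def c0Algebra [LocallyCompactSpace X] [LocallyCompactSpace Y] (hsurj : Function.Surjective π) :
    C0Algebra Y (CrossedProduct θ) where
  hom := baseHom hθ hπ
  injective := by
    refine (injective_iff_map_eq_zero _).2 fun g hg => ZeroAtInftyContinuousMap.ext fun y => ?_
    obtain ⟨x, rfl⟩ := hsurj y
    -- A degree-zero symbol with value `1` at a point over `y` detects the value of `g` at `y`.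
    obtain ⟨χ, hχ, -⟩ := ZeroAtInftyContinuousMap.exists_cutoff (isCompact_singleton (x := x))
      isClosed_empty (Set.disjoint_empty _)
    set f : N θ 0 := ⟨χ, fun z hz => absurd (rel_zero.2 rfl : Rel θ 0 z z).1 hz⟩
    have h : baseOp θ hπ g (sym θ 0 f) = 0 :=
      congrArg (fun m : 𝓜(ℂ, CrossedProduct θ) => m.fst (sym θ 0 f)) hg
    have h2 := norm_apply_le_norm_sym (baseMulN hπ g f) x
    rw [← baseOp_sym hθ, h, norm_zero, norm_le_zero_iff] at h2
    have h3 : g (π x) * χ x = 0 := h2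
    rwa [hχ x rfl, mul_one] at h3
  central g m := by
    -- Both halves of a multiplier are module maps, so they commute with an operator that can be
    -- moved across products on either side.
    have hm : ∀ a b, m.fst (a * b) = m.fst a * b := fun a b =>
      C0Algebra.eq_of_mul_left fun x => by
        rw [← m.central, ← mul_assoc, m.central, mul_assoc]
    have hm' : ∀ a b, m.snd (a * b) = a * m.snd b := fun a b =>
      C0Algebra.eq_of_mul_right fun x => by
        rw [m.central, mul_assoc, ← m.central, mul_assoc]
    have h1 : baseOp θ hπ g * m.fst = m.fst * baseOp θ hπ g := by
      refine ContinuousLinearMap.ext fun a => C0Algebra.eq_of_mul_right fun b => ?_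
      change baseOp θ hπ g (m.fst a) * b = m.fst (baseOp θ hπ g a) * b
      rw [← hm, ← baseOp_mul hθ, ← baseOp_mul hθ, ← mul_baseOp hθ, ← mul_baseOp hθ, hm]
    have h2 : m.snd * baseOp θ hπ g = baseOp θ hπ g * m.snd := by
      refine ContinuousLinearMap.ext fun a => C0Algebra.eq_of_mul_left fun b => ?_
      change b * m.snd (baseOp θ hπ g a) = b * baseOp θ hπ g (m.snd a)
      rw [← hm', mul_baseOp hθ, mul_baseOp hθ, ← hm', baseOp_mul hθ, hm', hm', baseOp_mul hθ]
    exact DoubleCentralizer.ext _ _ _ _ (Prod.ext h1 h2)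
  nondegenerate := by
    refine eq_top_of_sym_mem (Submodule.isClosed_topologicalClosure _) fun k f => ?_
    refine Metric.mem_closure_iff.2 fun ε hε => ?_
    obtain ⟨g, -, hg⟩ := exists_norm_sym_sub_baseOp_le hπ hθ f isClosed_empty
      (fun _ => False.elim) (half_pos hε)
    refine ⟨_, Submodule.subset_span ⟨g, sym θ k f, rfl⟩, ?_⟩
    rw [dist_eq_norm]
    exact hg.trans_lt (half_lt_self hε)

/-! ### The fibres -/

/-- The restriction of the crossed product to a fibre of `π`. -/
def toFiber (y : Y) : CrossedProduct θ →L[ℂ] CrossedProduct (fiber θ hθ y) :=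
  extend (ofLin (fiber θ hθ y) ∘ₗ
    { toFun := restrictHom hθ hπ y
      map_add' := map_add (restrictHom hθ hπ y)
      map_smul' := map_smul (restrictHom hθ hπ y) })

theorem norm_of_restrictHom (y : Y) (a : Alg θ) :
    ‖of (fiber θ hθ y) (restrictHom hθ hπ y a)‖ = fiberNorm hθ hπ y a := rfl

theorem norm_of_restrictHom_le (y : Y) (a : Alg θ) :
    ‖of (fiber θ hθ y) (restrictHom hθ hπ y a)‖ ≤ 1 * universalNorm θ a := by
  rw [one_mul]
  exact fiberNorm_le hθ hπ y a

theorem toFiber_of (y : Y) (a : Alg θ) :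
    toFiber hθ hπ y (of θ a) = of (fiber θ hθ y) (restrictHom hθ hπ y a) :=
  extend_of (norm_of_restrictHom_le hθ hπ y) a

theorem norm_toFiber_of (y : Y) (a : Alg θ) : ‖toFiber hθ hπ y (of θ a)‖ = fiberNorm hθ hπ y a := by
  rw [toFiber_of, norm_of_restrictHom]

theorem toFiber_sym (y : Y) (k : ℤ) (f : N θ k) :
    toFiber hθ hπ y (sym θ k f) = sym (fiber θ hθ y) k (restrictN hθ hπ y f) := by
  unfold sym
  rw [toFiber_of, restrictHom_sym]

theorem norm_toFiber_le (y : Y) (a : CrossedProduct θ) : ‖toFiber hθ hπ y a‖ ≤ ‖a‖ :=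
  (norm_extend_le (norm_of_restrictHom_le hθ hπ y) a).trans_eq (one_mul _)

theorem toFiber_mul (y : Y) (a b : CrossedProduct θ) :
    toFiber hθ hπ y (a * b) = toFiber hθ hπ y a * toFiber hθ hπ y b := by
  refine CStarSeminorm.Completion.ind₂ (P := fun a b =>
    toFiber hθ hπ y (a * b) = toFiber hθ hπ y a * toFiber hθ hπ y b)
    (isClosed_eq (by fun_prop) (by fun_prop)) (fun a b => ?_) a b
  change toFiber hθ hπ y (of θ a * of θ b) = toFiber hθ hπ y (of θ a) * toFiber hθ hπ y (of θ b)
  rw [← map_mul, toFiber_of, toFiber_of, toFiber_of, map_mul, map_mul]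

theorem toFiber_star (y : Y) (a : CrossedProduct θ) :
    toFiber hθ hπ y (star a) = star (toFiber hθ hπ y a) := by
  refine CStarSeminorm.Completion.ind (P := fun a =>
    toFiber hθ hπ y (star a) = star (toFiber hθ hπ y a))
    (isClosed_eq (by fun_prop) (by fun_prop)) (fun a => ?_) a
  change toFiber hθ hπ y (star (of θ a)) = star (toFiber hθ hπ y (of θ a))
  rw [← map_star (of θ), toFiber_of, toFiber_of, map_star (restrictHom hθ hπ y), map_star (of _)]

theorem toFiber_baseOp (y : Y) (g : C₀(Y, ℂ)) (a : CrossedProduct θ) :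
    toFiber hθ hπ y (baseOp θ hπ g a) = g y • toFiber hθ hπ y a := by
  have h : (toFiber hθ hπ y).comp (baseOp θ hπ g) = g y • toFiber hθ hπ y := clm_ext fun a => by
    change toFiber hθ hπ y (baseOp θ hπ g (of θ a)) = g y • toFiber hθ hπ y (of θ a)
    rw [baseOp_of hθ, toFiber_of, toFiber_of, ← map_smul]
    refine of_eq_of_orbitRep fun x => ?_
    rw [map_smul, orbitRep_restrictHom, orbitRep_restrictHom, orbitRep_baseMulAlg hθ]
    rw [show π x.1 = y from x.2]
  exact congrArg (fun T => T a) h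

/-! ### The quotient norm equals the norm over the fibre -/

variable [LocallyCompactSpace X] [LocallyCompactSpace Y] (hsurj : Function.Surjective π)

theorem toFiber_eq_zero {y : Y} {a : CrossedProduct θ}
    (ha : a ∈ (c0Algebra hθ hπ hsurj).ideal y) : toFiber hθ hπ y a = 0 := by
  refine closure_minimal (t := {a | toFiber hθ hπ y a = 0}) (fun b hb => ?_)
    (isClosed_eq (toFiber hθ hπ y).continuous continuous_const) ha
  refine Submodule.span_le (p := LinearMap.ker (toFiber hθ hπ y).toLinearMap).2 ?_ hb
  rintro _ ⟨g, a, hg, rfl⟩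
  change toFiber hθ hπ y (baseOp θ hπ g a) = 0
  rw [toFiber_baseOp, hg, zero_smul]

/-- Each coefficient is a limit of its multiples by functions that vanish at `y`, and there are
finitely many nonzero coefficients. -/
theorem of_mem_ideal {y : Y} {a : Alg θ} (ha : ∀ k x, π x = y → (Alg.coeff k a).1 x = 0) :
    of θ a ∈ (c0Algebra hθ hπ hsurj).ideal y := by
  refine of_mem_of_sym_mem fun k => ?_
  refine (C0Algebra.isClosed_ideal (c0Algebra hθ hπ hsurj) y).closure_subset ?_
  refine Metric.mem_closure_iff.2 fun ε hε => ?_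
  obtain ⟨g, hg0, hg⟩ := exists_norm_sym_sub_baseOp_le hπ hθ (Alg.coeff k a)
    (isClosed_singleton (x := y)) (ha k) (half_pos hε)
  refine ⟨_, C0Algebra.mem_ideal y (hg0 y rfl) (sym θ k (Alg.coeff k a)), ?_⟩
  rw [dist_eq_norm]
  exact hg.trans_lt (half_lt_self hε)

theorem coeff_baseMulAlg (g : C₀(Y, ℂ)) (k : ℤ) (a : Alg θ) :
    Alg.coeff k (baseMulAlg θ hπ g a) = baseMulN hπ g (Alg.coeff k a) := by
  have h0 : baseMulN hπ g (0 : N θ k) = 0 :=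
    Subtype.ext <| ZeroAtInftyContinuousMap.ext fun x => mul_zero (g (π x))
  refine Alg.ind (P := fun a => Alg.coeff k (baseMulAlg θ hπ g a) =
    baseMulN hπ g (Alg.coeff k a)) ?_ (fun l f => ?_) (fun a b ha hb => ?_) a
  · rw [map_zero, map_zero, h0]
  · rw [baseMulAlg_sym]
    by_cases h : l = k
    · subst h
      rw [Alg.coeff_sym_self, Alg.coeff_sym_self]
    · rw [Alg.coeff_sym_of_ne h, Alg.coeff_sym_of_ne h, h0]
  · rw [map_add, map_add, map_add, ha, hb]
    exact Subtype.ext <| ZeroAtInftyContinuousMap.ext fun x =>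
      (mul_add (g (π x)) ((Alg.coeff k a).1 x) ((Alg.coeff k b).1 x)).symm

theorem norm_loc_of_le (hopen : IsOpenMap π) (y : Y) (a : Alg θ) :
    ‖(c0Algebra hθ hπ hsurj).loc y (of θ a)‖ ≤ fiberNorm hθ hπ y a := by
  refine le_of_forall_pos_le_add fun ε hε => ?_
  -- Over `U` all orbit norms of `a` are already within `ε` of the required bound; outside `U` the
  -- cutoff removes them.
  set U : Set Y := {z | fiberNorm hθ hπ z a < fiberNorm hθ hπ y a + ε}
  have hU : IsOpen U := isOpen_lt (continuous_fiberNorm hθ hπ hopen a) continuous_const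
  have hyU : y ∈ U := lt_add_of_pos_right (fiberNorm hθ hπ y a) hε
  obtain ⟨χ, hχ1, hχ0, -, hχ, -⟩ := ZeroAtInftyContinuousMap.exists_cutoff
    (isCompact_singleton (x := y)) hU.isClosed_compl
    (Set.disjoint_singleton_left.2 fun h => h hyU)
  -- Since the cutoff is `1` at `y`, the coefficients of the difference vanish on the fibre, so the
  -- class at `y` is unchanged.
  have h1 : (c0Algebra hθ hπ hsurj).loc y (of θ a) =
      (c0Algebra hθ hπ hsurj).loc y (of θ (baseMulAlg θ hπ χ a)) := by
    rw [C0Algebra.Fiber.loc_eq, ← map_sub]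
    refine of_mem_ideal hθ hπ hsurj fun k x hx => ?_
    rw [map_sub, coeff_baseMulAlg]
    change (Alg.coeff k a).1 x - χ (π x) * (Alg.coeff k a).1 x = 0
    rw [hx, hχ1 y rfl, one_mul, sub_self]
  rw [h1]
  have hC : 0 ≤ fiberNorm hθ hπ y a + ε := add_nonneg (CStarSeminorm.nonneg _ a) hε.le
  refine ((C0Algebra.norm_loc_le _ y _).trans_eq (norm_of _)).trans
    (universalNorm_baseMulAlg_le hθ hπ χ hC fun x => ?_)
  by_cases hx : π x ∈ U
  · exact (mul_le_of_le_one_left (CStarSeminorm.nonneg _ a) (hχ _)).trans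
      ((orbitNorm_le_fiberNorm hθ hπ x a).trans (le_of_lt hx))
  · rw [hχ0 _ hx, norm_zero, zero_mul]
    exact hC

/-- One inequality extends by density from `norm_loc_of_le`; the other holds because restriction is
contractive and vanishes on the ideal. -/
theorem norm_loc (hopen : IsOpenMap π) (y : Y) (a : CrossedProduct θ) :
    ‖(c0Algebra hθ hπ hsurj).loc y a‖ = ‖toFiber hθ hπ y a‖ := by
  refine le_antisymm ?_ ?_
  · refine denseRange_of.induction_on
      (p := fun a => ‖(c0Algebra hθ hπ hsurj).loc y a‖ ≤ ‖toFiber hθ hπ y a‖) a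
      (isClosed_le (C0Algebra.continuous_loc _ y).norm (toFiber hθ hπ y).continuous.norm)
      fun a => ?_
    rw [norm_toFiber_of]
    exact norm_loc_of_le hθ hπ hsurj hopen y a
  · rw [C0Algebra.Fiber.norm_loc]
    refine (Metric.le_infDist ⟨0, zero_mem _⟩).2 fun b hb => ?_
    rw [dist_eq_norm, ← sub_zero (toFiber hθ hπ y a), ← toFiber_eq_zero hθ hπ hsurj hb, ← map_sub]
    exact norm_toFiber_le hθ hπ y _

/-- Restrictions to fibres are contractive uniformly in `y`, so the norm function of `a` is a
uniform limit of those of elements of the dense ⋆-algebra. -/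
theorem isContinuousField_c0Algebra (hopen : IsOpenMap π) :
    (c0Algebra hθ hπ hsurj).IsContinuousField := fun a => by
  simp only [norm_loc hθ hπ hsurj hopen]
  refine continuous_of_uniform_approx_of_continuous fun u hu => ?_
  obtain ⟨ε, hε, hu⟩ := Metric.mem_uniformity_dist.1 hu
  obtain ⟨b, hb⟩ := Metric.denseRange_iff.1 denseRange_of a ε hε
  refine ⟨fun y => ‖toFiber hθ hπ y (of θ b)‖, ?_, fun y => hu ?_⟩
  · simp only [norm_toFiber_of]
    exact continuous_fiberNorm hθ hπ hopen b
  · rw [dist_eq_norm] at hb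
    refine lt_of_le_of_lt ?_ hb
    refine (abs_norm_sub_norm_le _ _).trans ?_
    rw [← map_sub]
    exact norm_toFiber_le hθ hπ y _

/-- The isometry of the localisation at `y` to the crossed product over the fibre. -/
def fiberIsometry (hopen : IsOpenMap π) (y : Y) :
    (c0Algebra hθ hπ hsurj).Fiber y →ₗᵢ[ℂ] CrossedProduct (fiber θ hθ y) where
  toLinearMap := ((c0Algebra hθ hπ hsurj).ideal y).liftQ (toFiber hθ hπ y).toLinearMap
    fun _ ha => toFiber_eq_zero hθ hπ hsurj ha
  norm_map' := C0Algebra.Fiber.loc_surjective.forall.2 fun a =>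
    (norm_loc hθ hπ hsurj hopen y a).symm

theorem fiberIsometry_loc (hopen : IsOpenMap π) (y : Y) (a : CrossedProduct θ) :
    fiberIsometry hθ hπ hsurj hopen y ((c0Algebra hθ hπ hsurj).loc y a) = toFiber hθ hπ y a := rfl

theorem exists_norm_sub_restrictN_le [NormalSpace X] (y : Y) {k : ℤ} (f : N (fiber θ hθ y) k)
    {ε : ℝ} (hε : 0 < ε) : ∃ F : N θ k, ‖(f - restrictN hθ hπ y F).1‖ ≤ ε := by
  obtain ⟨F, hF0, hF⟩ := exists_norm_restrict_sub_le hπ y (zpow θ k).open_source f.1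
    (fun x hx => f.2 x fun h => hx ((mem_source_fiber_iff hθ y k x).1 h)) hε
  rw [norm_sub_rev] at hF
  exact ⟨⟨F, hF0⟩, hF⟩

theorem surjective_fiberIsometry [NormalSpace X] (hopen : IsOpenMap π) (y : Y) :
    Function.Surjective (fiberIsometry hθ hπ hsurj hopen y) := by
  -- The localisation is complete, so its isometric image is closed, and it suffices to approximate
  -- symbols.
  have hcl : IsClosed (Set.range (fiberIsometry hθ hπ hsurj hopen y)) :=
    (fiberIsometry hθ hπ hsurj hopen y).isometry.isClosedEmbedding.isClosed_range
  let p : Submodule ℂ (CrossedProduct (fiber θ hθ y)) :=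
    LinearMap.range (fiberIsometry hθ hπ hsurj hopen y).toLinearMap
  have hp : p = ⊤ := by
    refine eq_top_of_sym_mem (p := p) hcl fun k f => ?_
    refine hcl.closure_subset (Metric.mem_closure_iff.2 fun ε hε => ?_)
    obtain ⟨F, hF⟩ := exists_norm_sub_restrictN_le hθ hπ y f (half_pos hε)
    refine ⟨_, ⟨(c0Algebra hθ hπ hsurj).loc y (sym θ k F), rfl⟩, ?_⟩
    rw [fiberIsometry_loc, toFiber_sym, dist_eq_norm, sym_sub]
    exact ((norm_sym_le _).trans hF).trans_lt (half_lt_self hε)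
  exact LinearMap.range_eq_top.1 hp

/-- The localisation of the crossed product at `y` is the crossed product over the fibre. -/
def fiberEquiv [NormalSpace X] (hopen : IsOpenMap π) (y : Y) :
    (c0Algebra hθ hπ hsurj).Fiber y ≃⋆ₐ[ℂ] CrossedProduct (fiber θ hθ y) where
  __ := Equiv.ofBijective (fiberIsometry hθ hπ hsurj hopen y)
    ⟨(fiberIsometry hθ hπ hsurj hopen y).injective, surjective_fiberIsometry hθ hπ hsurj hopen y⟩
  map_mul' := C0Algebra.Fiber.loc_surjective.forall₂.2 (toFiber_mul hθ hπ y)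
  map_add' := map_add (fiberIsometry hθ hπ hsurj hopen y)
  map_star' := C0Algebra.Fiber.loc_surjective.forall.2 (toFiber_star hθ hπ y)
  map_smul' := map_smul (fiberIsometry hθ hπ hsurj hopen y)

end

end CrossedProduct

theorem mainTheorem6 {Y H : Type*}
    [TopologicalSpace Y] [T2Space Y] [LocallyCompactSpace Y] [SecondCountableTopology Y]
    [TopologicalSpace H] [T2Space H] [LocallyCompactSpace H] [SecondCountableTopology H]
    (π : H → Y) (hπ : Continuous π) (hopen : IsOpenMap π) (hsurj : Function.Surjective π)
    (θ : OpenPartialHomeomorph H H) (hθ : ∀ x ∈ θ.source, π (θ x) = π x) :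
    ∃ S : C0Algebra Y (CrossedProduct θ),
      (∀ (g : C₀(Y, ℂ)) (k : ℤ) (f : PartialAut.N θ k),
        (S.hom g).fst (CrossedProduct.sym θ k f) =
          CrossedProduct.sym θ k (PartialAut.baseMulN hπ g f)) ∧
      S.IsContinuousField ∧
      ∀ y : Y, ∃ Φ : S.Fiber y ≃⋆ₐ[ℂ] CrossedProduct (PartialAut.fiber θ hθ y),
        (∀ a : S.Fiber y, ‖Φ a‖ = ‖a‖) ∧
        ∀ (k : ℤ) (f : PartialAut.N θ k),
          Φ (S.loc y (CrossedProduct.sym θ k f)) =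
            CrossedProduct.sym (PartialAut.fiber θ hθ y) k (PartialAut.restrictN hθ hπ y f) := by
  -- Second countability of `H` enters through normality, needed for the Tietze extension from a
  -- fibre.
  refine ⟨CrossedProduct.c0Algebra hθ hπ hsurj, fun g k f => CrossedProduct.baseOp_sym hθ hπ g k f,
    CrossedProduct.isContinuousField_c0Algebra hθ hπ hsurj hopen, fun y =>
      ⟨CrossedProduct.fiberEquiv hθ hπ hsurj hopen y,
        (CrossedProduct.fiberIsometry hθ hπ hsurj hopen y).norm_map,
        fun k f => CrossedProduct.toFiber_sym hθ hπ y k f⟩⟩
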